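/- Let $\mathcal H\neq 0$ be a complex Hilbert space, of finite or infinite dimension, with inner product $(\cdot|\cdot)$ linear in the second argument. Let $\mathbf P(\mathcal H)$ be the set of its rays $\hat\varphi=\mathbb C\varphi$, $\varphi\ne 0$, with the quotient topology and with the charts, for $\|\varphi\|=1$, $$b_\varphi:\{\hat\psi:(\varphi|\psi)\neq 0\}\to\varphi^\perp,\qquad b_\varphi(\hat\psi)=\frac{\psi}{(\varphi|\psi)}-\varphi .$$ Let $U(\mathcal H)$ be the unitary group with the norm topology and its structure of real Banach manifold modelled on the space $\mathfrak u(\mathcal H)$ of bounded skew-adjoint operators, acting on $\mathbf P(\mathcal H)$ by $g\hat\varphi=\widehat{g\varphi}$. Let $\chi\in\mathcal H$ be a unit vector, $P_\chi$ the orthogonal projection onto $\mathbb C\chi$, $S=1-2P_\chi$, $\sigma(g)=SgS^{-1}$, and $\hbar>0$. 1. $(\mathbf P(\mathcal H),U(\mathcal H),S)$ is a complex symmetric homogeneous $U(\mathcal H)$-space with base point $\hat\chi$. That is: * $U(\mathcal H)$ is a connected Hausdorff Banach Lie group, and $\mathbf P(\mathcal H)$ is a connected Hausdorff complex Banach manifold,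 second countable if $\mathcal H$ is separable. * The action is smooth and transitive, every $g\in U(\mathcal H)$ acts biholomorphically, every isotropy group is a Lie subgroup (a subgroup which is a split submanifold), and the orbit map $g\mapsto g\hat\chi$ is an open quotient map. * The map $s$ induced by $S$ is an involutive diffeomorphism with isolated fixed point $\hat\chi$. For $x=g\hat\chi$ the symmetry $s_x=g\,s\,g^{-1}$ depends only on $x$ and is biholomorphic. The automorphism $\sigma$ of the Lie group $U(\mathcal H)$ is smooth and involutive, and $s(gx)=\sigma(g)s(x)$. 2. The isotropy group $U_{\hat\chi}$ of $\hat\chi$ is the stabiliser of the line $\mathbb C\chi$. It is equal to the commutant of $P_\chi$ in $U(\mathcal H)$ and to the fixed point group of $\sigma$. The tangent space of $U(\mathcal H)$ at $1$ is $\mathfrak u(\mathcal H)$, and the Lie algebra of $U_{\hat\chi}$ is the commutant $\mathfrak h$ of $P_\chi$ in $\mathfrak u(\mathcal H)$. The differential of $\sigma$ at $1$ is $A\mapsto SAS^{-1}$, and its $(-1)$-eigenspace is $\mathfrak m=\{A\in\mathfrak u(\mathcal H): SA=-AS\}$. One has $\mathfrak u(\mathcal H)=\mathfrak h\oplus\mathfrak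 m$, and $\mathfrak m$ is $\mathrm{Ad}(U_{\hat\chi})$-invariant. 3. The differential at $1$ of the orbit map $g\mapsto g\hat\chi$ has kernel $\mathfrak h$ and maps $\mathfrak m$ bijectively onto $T_{\hat\chi}\mathbf P(\mathcal H)$. In the chart $b_\chi$ it is $A\mapsto A\chi\in\chi^\perp$ on $\mathfrak m$, and it carries the complex structure of $\mathfrak m$ coming from $\chi^\perp$ to that of $\mathbf P(\mathcal H)$. 4. For $A,B\in\mathfrak m$ the operator $AB$ has a trace, and $(A,B)=-\hbar\,\mathrm{Tr}(AB)$ is a real, bounded, $\mathrm{Ad}(U_{\hat\chi})$-invariant, positive definite symmetric bilinear form on $\mathfrak m$. There is exactly one smooth $U(\mathcal H)$-invariant Riemannian metric on $\mathbf P(\mathcal H)$ which at $\hat\chi$ is this form, under the identification $\mathfrak m\cong T_{\hat\chi}\mathbf P(\mathcal H)$ of 3. It is the Fubini–Study metric with constant $\hbar$: for every unit vector $\varphi$ and all $v,w\in T_{\hat\varphi}\mathbf P(\mathcal H)$, $$\mathbf g_{\hat\varphi}(v,w)=2\hbar\,\mathrm{Re}\,(T_{\hat\varphi}b_\varphi(v)\,|\,T_{\hat\varphi}b_\varphi(w)).$$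 -/

import Mathlib

open scoped Manifold ContDiff LinearAlgebra.Projectivization InnerProductSpace Topology

namespace ProjectiveHilbert

universe u

/-! ### The projective space of a Hilbert space as a topological space -/

section Projective

variable {H : Type u} [NormedAddCommGroup H] [InnerProductSpace ℂ H]

/-- The quotient topology on the space of rays of `H`. -/
instance : TopologicalSpace (ℙ ℂ H) :=
  inferInstanceAs (TopologicalSpace (Quotient (projectivizationSetoid ℂ H)))

theorem isQuotientMap_mk :
    Topology.IsQuotientMap (fun v : {v : H // v ≠ 0} => Projectivization.mk ℂ v.1 v.2) :=
  isQuotientMap_quot_mk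

/-- The affine coordinate `b_φ` at the unit vector `φ`: it sends the ray of `v`, where
`⟪φ, v⟫ ≠ 0`, to `v / ⟪φ, v⟫ - φ`, that is to the component of `v / ⟪φ, v⟫` in the orthogonal
complement of `φ`. -/
noncomputable def affineCoord (φ : H) (x : ℙ ℂ H) : (ℂ ∙ φ)ᗮ :=
  (ℂ ∙ φ)ᗮ.orthogonalProjectionOnto ((⟪φ, x.rep⟫_ℂ)⁻¹ • x.rep)

theorem affineCoord_mk (φ v : H) (hv : v ≠ 0) :
    affineCoord φ (Projectivization.mk ℂ v hv) =
      (ℂ ∙ φ)ᗮ.orthogonalProjectionOnto ((⟪φ, v⟫_ℂ)⁻¹ • v) := by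
  obtain ⟨a, ha⟩ := Projectivization.exists_smul_eq_mk_rep ℂ v hv
  unfold affineCoord
  rw [← ha, Units.smul_def, inner_smul_right, smul_smul, mul_inv, mul_right_comm,
    inv_mul_cancel₀ a.ne_zero, one_mul]

theorem coe_affineCoord_mk (φ v : H) (hφ : ‖φ‖ = 1) (hv : v ≠ 0) (h : ⟪φ, v⟫_ℂ ≠ 0) :
    (affineCoord φ (Projectivization.mk ℂ v hv) : H) = (⟪φ, v⟫_ℂ)⁻¹ • v - φ := by
  rw [affineCoord_mk, ← Submodule.starProjection_apply, Submodule.starProjection_orthogonal_val,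
    Submodule.starProjection_singleton]
  simp [inner_smul_right, hφ, h]

theorem inner_add_orthogonal (φ : H) (hφ : ‖φ‖ = 1) (u : (ℂ ∙ φ)ᗮ) : ⟪φ, φ + (u : H)⟫_ℂ = 1 := by
  rw [inner_add_right, Submodule.mem_orthogonal_singleton_iff_inner_right.1 u.2,
    inner_self_eq_norm_sq_to_K, hφ]
  simp

theorem add_orthogonal_ne_zero (φ : H) (hφ : ‖φ‖ = 1) (u : (ℂ ∙ φ)ᗮ) : φ + (u : H) ≠ 0 := by
  intro h
  have := inner_add_orthogonal φ hφ u
  simp [h] at this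

theorem inner_rep_ne_zero_iff (φ v : H) (hv : v ≠ 0) :
    ⟪φ, (Projectivization.mk ℂ v hv).rep⟫_ℂ ≠ 0 ↔ ⟪φ, v⟫_ℂ ≠ 0 := by
  obtain ⟨a, ha⟩ := Projectivization.exists_smul_eq_mk_rep ℂ v hv
  rw [← ha, Units.smul_def, inner_smul_right]
  simp

theorem isOpen_inner_rep_ne_zero (φ : H) : IsOpen {x : ℙ ℂ H | ⟪φ, x.rep⟫_ℂ ≠ 0} := by
  rw [← isQuotientMap_mk.isOpen_preimage]
  have : (fun v : {v : H // v ≠ 0} => Projectivization.mk ℂ v.1 v.2) ⁻¹'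
      {x | ⟪φ, x.rep⟫_ℂ ≠ 0} = {v | ⟪φ, v.1⟫_ℂ ≠ 0} := by
    ext v
    exact inner_rep_ne_zero_iff φ v.1 v.2
  rw [this]
  exact isOpen_ne_fun (by fun_prop) (by fun_prop)

/-- The affine chart `b_φ` of the projective space at a unit vector `φ`, with domain the rays not
orthogonal to `φ`. -/
noncomputable def affineChart (φ : H) (hφ : ‖φ‖ = 1) :
    OpenPartialHomeomorph (ℙ ℂ H) (ℂ ∙ φ)ᗮ where
  toFun := affineCoord φ
  invFun u := Projectivization.mk ℂ (φ + (u : H)) (add_orthogonal_ne_zero φ hφ u)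
  source := {x | ⟪φ, x.rep⟫_ℂ ≠ 0}
  target := Set.univ
  map_source' _ _ := Set.mem_univ _
  map_target' u _ := (inner_rep_ne_zero_iff φ _ _).2 (by simp [inner_add_orthogonal φ hφ u])
  left_inv' x hx := by
    induction x using Projectivization.ind with | h v hv => ?_
    have h : ⟪φ, v⟫_ℂ ≠ 0 := (inner_rep_ne_zero_iff φ v hv).1 hx
    rw [Projectivization.mk_eq_mk_iff']
    refine ⟨(⟪φ, v⟫_ℂ)⁻¹, ?_⟩
    rw [coe_affineCoord_mk φ v hφ hv h]
    abel
  right_inv' u _ := by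
    ext
    rw [coe_affineCoord_mk φ _ hφ _ (by rw [inner_add_orthogonal φ hφ]; simp),
      inner_add_orthogonal φ hφ]
    simp
  open_source := isOpen_inner_rep_ne_zero φ
  open_target := isOpen_univ
  continuousOn_toFun := by
    rw [isQuotientMap_mk.continuousOn_isOpen_iff (isOpen_inner_rep_ne_zero φ)]
    have h : ContinuousOn (fun v : {v : H // v ≠ 0} =>
        (ℂ ∙ φ)ᗮ.orthogonalProjectionOnto ((⟪φ, v.1⟫_ℂ)⁻¹ • v.1)) {v | ⟪φ, v.1⟫_ℂ ≠ 0} := by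
      refine (ContinuousLinearMap.continuous _).comp_continuousOn ?_
      refine ContinuousOn.smul (ContinuousOn.inv₀ ?_ fun v hv => hv) ?_ <;> fun_prop
    refine (h.mono fun v hv => (inner_rep_ne_zero_iff φ v.1 v.2).1 hv).congr fun v _ => ?_
    exact affineCoord_mk φ v.1 v.2
  continuousOn_invFun := by
    have h : Continuous fun u : (ℂ ∙ φ)ᗮ =>
        (⟨φ + (u : H), add_orthogonal_ne_zero φ hφ u⟩ : {v : H // v ≠ 0}) := by
      fun_prop
    exact (isQuotientMap_mk.continuous.comp h).continuousOn

/-- Any two unit vectors have isometric orthogonal complements. -/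
theorem exists_orthogonal_isometry (φ e : H) (hφ : ‖φ‖ = 1) (he : ‖e‖ = 1) :
    Nonempty ((ℂ ∙ φ)ᗮ ≃ₗᵢ[ℂ] (ℂ ∙ e)ᗮ) := by
  obtain ⟨c, hc, hreal⟩ : ∃ c : ℂ, ‖c‖ = 1 ∧ ⟪φ, c • e⟫_ℂ = ⟪c • e, φ⟫_ℂ := by
    by_cases h : ⟪φ, e⟫_ℂ = 0
    · refine ⟨1, by simp, ?_⟩
      rw [one_smul, h, ← inner_conj_symm, h, map_zero]
    · refine ⟨(‖⟪φ, e⟫_ℂ‖ : ℂ) / ⟪φ, e⟫_ℂ, by simp [h], ?_⟩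
      rw [← inner_conj_symm (_ • e) φ, inner_smul_right, div_mul_cancel₀ _ h, Complex.conj_ofReal]
  set w : H := c • e with hw
  have hwn : ‖w‖ = 1 := by rw [hw, norm_smul, hc, he, one_mul]
  have hc0 : c ≠ 0 := by rintro rfl; simp at hc
  have hrefl : (ℂ ∙ (φ - w))ᗮ.reflection φ = w := by
    have h1 : φ + w ∈ (ℂ ∙ (φ - w))ᗮ := by
      rw [Submodule.mem_orthogonal_singleton_iff_inner_right, inner_add_right, inner_sub_left,
        inner_sub_left, hreal, inner_self_eq_norm_sq_to_K, inner_self_eq_norm_sq_to_K, hφ, hwn]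
      ring
    have h2 : (ℂ ∙ (φ - w))ᗮ.reflection (φ + w) = φ + w :=
      Submodule.reflection_mem_subspace_eq_self h1
    have h3 : (ℂ ∙ (φ - w))ᗮ.reflection (φ - w) = -(φ - w) :=
      Submodule.reflection_orthogonalComplement_singleton_eq_neg _
    have h4 : (2 : ℂ) • (ℂ ∙ (φ - w))ᗮ.reflection φ = (2 : ℂ) • w := by
      rw [← map_smul, show (2 : ℂ) • φ = (φ + w) + (φ - w) by rw [two_smul]; abel, map_add, h2, h3,
        two_smul]
      abel
    exact smul_right_injective H (two_ne_zero : (2 : ℂ) ≠ 0) h4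
  have hmap : (ℂ ∙ φ)ᗮ.map (((ℂ ∙ (φ - w))ᗮ.reflection).toLinearEquiv : H →ₗ[ℂ] H) =
      (ℂ ∙ e)ᗮ := by
    rw [Submodule.map_orthogonal_equiv, Submodule.map_span, Set.image_singleton]
    have : ((((ℂ ∙ (φ - w))ᗮ.reflection).toLinearEquiv : H →ₗ[ℂ] H)) φ = c • e := hrefl
    rw [this, Submodule.span_singleton_smul_eq (IsUnit.mk0 c hc0)]
  exact ⟨(LinearIsometryEquiv.submoduleMap _ ((ℂ ∙ (φ - w))ᗮ.reflection)).trans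
    (LinearIsometryEquiv.ofEq _ _ hmap)⟩

variable [Nontrivial H]

variable (H) in
/-- A fixed unit vector of `H`, which only serves to fix the model space of the projective space. -/
noncomputable def baseVector : H := (exists_norm_eq H zero_le_one).choose

variable (H) in
theorem norm_baseVector : ‖baseVector H‖ = 1 := (exists_norm_eq H zero_le_one).choose_spec

variable (H) in
/-- The model Hilbert space of the projective space: the orthogonal complement of a unit vector. -/
abbrev PModel : Type u := (ℂ ∙ baseVector H)ᗮ

/-- The charts of the projective space: the affine charts `b_φ` at all unit vectors `φ`, followed by
any linear isometry of the orthogonal complement of `φ` with the model space. -/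
noncomputable def modelChart (φ : H) (hφ : ‖φ‖ = 1) (L : (ℂ ∙ φ)ᗮ ≃ₗᵢ[ℂ] PModel H) :
    OpenPartialHomeomorph (ℙ ℂ H) (PModel H) :=
  (affineChart φ hφ).trans L.toHomeomorph.toOpenPartialHomeomorph

theorem exists_modelChart (x : ℙ ℂ H) :
    ∃ φ : H, ∃ hφ : ‖φ‖ = 1, ∃ L : (ℂ ∙ φ)ᗮ ≃ₗᵢ[ℂ] PModel H, x ∈ (modelChart φ hφ L).source := by
  have h0 : ‖x.rep‖ ≠ 0 := norm_ne_zero_iff.2 x.rep_nonzero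
  have h1 : ‖((‖x.rep‖⁻¹ : ℝ) : ℂ) • x.rep‖ = 1 := by
    rw [norm_smul, Complex.norm_real, norm_inv, norm_norm, inv_mul_cancel₀ h0]
  obtain ⟨L⟩ := exists_orthogonal_isometry _ (baseVector H) h1 (norm_baseVector H)
  refine ⟨_, h1, L, ?_⟩
  have : ⟪((‖x.rep‖⁻¹ : ℝ) : ℂ) • x.rep, x.rep⟫_ℂ ≠ 0 := by
    rw [inner_smul_left]
    simp [x.rep_nonzero]
  simpa [modelChart, affineChart] using this

/-- The structure of charted space of the projective space, given by the affine charts. -/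
noncomputable instance : ChartedSpace (PModel H) (ℙ ℂ H) where
  atlas := {c | ∃ φ : H, ∃ hφ : ‖φ‖ = 1, ∃ L : (ℂ ∙ φ)ᗮ ≃ₗᵢ[ℂ] PModel H, c = modelChart φ hφ L}
  chartAt x := modelChart _ (exists_modelChart x).choose_spec.choose
    (exists_modelChart x).choose_spec.choose_spec.choose
  mem_chart_source x := (exists_modelChart x).choose_spec.choose_spec.choose_spec
  chart_mem_atlas _ := ⟨_, _, _, rfl⟩

theorem contDiffOn_transition {n : ℕ∞ω} {c c' : OpenPartialHomeomorph (ℙ ℂ H) (PModel H)}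
    (hc : c ∈ atlas (PModel H) (ℙ ℂ H)) (hc' : c' ∈ atlas (PModel H) (ℙ ℂ H)) :
    ContDiffOn ℂ n (c.symm.trans c') (c.symm.trans c').source := by
  obtain ⟨φ, hφ, L, rfl⟩ := hc
  obtain ⟨ψ, hψ, L', rfl⟩ := hc'
  have h : ContDiffOn ℂ n (fun u : PModel H => L' ((ℂ ∙ ψ)ᗮ.orthogonalProjectionOnto
      ((innerSL ℂ ψ (φ + (L.symm u : H)))⁻¹ • (φ + (L.symm u : H)))))
      {u | innerSL ℂ ψ (φ + (L.symm u : H)) ≠ 0} := by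
    have hlin : ContDiff ℂ n (fun u : PModel H => φ + (L.symm u : H)) :=
      contDiff_const.add
        (((ℂ ∙ φ)ᗮ.subtypeL.comp (L.symm.toContinuousLinearEquiv :
          PModel H →L[ℂ] (ℂ ∙ φ)ᗮ)).contDiff)
    refine (L'.contDiff.comp (ContinuousLinearMap.contDiff _)).comp_contDiffOn ?_
    refine ContDiffOn.smul (ContDiffOn.inv ?_ fun u hu => hu) hlin.contDiffOn
    exact ((innerSL ℂ ψ).contDiff.comp hlin).contDiffOn
  refine (h.mono fun u hu => ?_).congr fun u _ => ?_
  · have hu' : u ∈ ((modelChart φ hφ L).symm.trans (modelChart ψ hψ L')).source := hu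
    simp only [modelChart, affineChart, mfld_simps] at hu'
    exact (inner_rep_ne_zero_iff ψ _ (add_orthogonal_ne_zero φ hφ (L.symm u))).1 (by simpa using hu')
  · exact congrArg L' (affineCoord_mk ψ _ (add_orthogonal_ne_zero φ hφ (L.symm u)))

/-- The projective space is a complex (analytic) manifold. -/
instance : IsManifold 𝓘(ℂ, PModel H) ω (ℙ ℂ H) :=
  isManifold_of_contDiffOn _ _ _ fun c c' hc hc' => by
    simpa using contDiffOn_transition hc hc'

/-- The projective space is a real smooth manifold. -/
instance : IsManifold 𝓘(ℝ, PModel H) ∞ (ℙ ℂ H) :=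
  isManifold_of_contDiffOn _ _ _ fun c c' hc hc' => by
    simpa using (contDiffOn_transition hc hc').restrict_scalars ℝ

end Projective

/-! ### The unitary group of a C*-algebra as a Banach manifold -/

section Unitary

variable {A : Type u} [CStarAlgebra A]

variable (A) in
/-- The real Banach space of skew-adjoint elements. -/
abbrev Skew : Type u := skewAdjoint.submodule ℝ A

theorem star_skew (a : Skew A) : star (a : A) = -a := skewAdjoint.mem_iff.1 a.2

theorem isUnit_one_sub_of_skew {b : A} (hb : star b = -b) : IsUnit (1 - b) := by
  have hsa : IsSelfAdjoint (Complex.I • b) := by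
    rw [isSelfAdjoint_iff, star_smul, hb]
    simp
  have h : Complex.I ∉ spectrum ℂ (Complex.I • b) := fun h => by
    have := hsa.mem_spectrum_eq_re h
    simp at this
  rw [spectrum.notMem_iff, Algebra.algebraMap_eq_smul_one, ← smul_sub] at h
  have h' := h.smul (Units.mk0 Complex.I Complex.I_ne_zero)⁻¹
  rwa [Units.smul_def, Units.val_inv_eq_inv_val, Units.val_mk0, inv_smul_smul₀ Complex.I_ne_zero] at h'

theorem isUnit_one_add_of_skew {b : A} (hb : star b = -b) : IsUnit (1 + b) := by
  simpa using isUnit_one_sub_of_skew (b := -b) (by rw [star_neg, hb])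

/-- The inverse Cayley transform `a ↦ (1 + a/2) (1 - a/2)⁻¹`, from skew-adjoint elements to unitary
elements. -/
noncomputable def cayleyInv (a : Skew A) : unitary A :=
  ⟨(1 + (2⁻¹ : ℝ) • (a : A)) * Ring.inverse (1 - (2⁻¹ : ℝ) • (a : A)), by
    set b : A := (2⁻¹ : ℝ) • (a : A) with hb
    have hb' : star b = -b := by rw [hb, star_smul, star_skew, smul_neg]; simp
    obtain ⟨p, hp⟩ := isUnit_one_add_of_skew hb'
    obtain ⟨q, hq⟩ := isUnit_one_sub_of_skew hb'
    have hpq : p * q = q * p := by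
      ext
      push_cast
      rw [hp, hq]
      noncomm_ring
    have hs : star (p : A) = q := by rw [hp, hq, star_add, hb', star_one, sub_eq_add_neg]
    have hs' : star q = p := by
      ext
      rw [Units.coe_star, ← hs, star_star]
    have hs'' : star p = q := by ext; rw [Units.coe_star, hs]
    rw [← hp, ← hq, Ring.inverse_unit, ← Units.val_mul, Unitary.mem_iff, ← Units.coe_star,
      ← Units.val_mul, ← Units.val_mul, star_mul, star_inv, hs', hs'']
    have hc : Commute p q := hpq
    constructor
    · rw [show p⁻¹ * q * (p * q⁻¹) = p⁻¹ * (q * p) * q⁻¹ by group, ← hpq]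
      simp
    · rw [show p * q⁻¹ * (p⁻¹ * q) = p * (q⁻¹ * p⁻¹) * q by group, ← mul_inv_rev, hpq, mul_inv_rev]
      simp⟩

/-- The Cayley transform `g ↦ 2 (g - 1) (g + 1)⁻¹`, defined where `g + 1` is invertible. -/
noncomputable def cayley (g : unitary A) : Skew A :=
  ⟨(2 : ℝ) • (((g : A) - 1) * Ring.inverse ((g : A) + 1)), by
    refine Submodule.smul_mem _ _ ?_
    by_cases h : IsUnit ((g : A) + 1)
    · obtain ⟨x, hx⟩ := h
      have h1 : star (g : A) * g = 1 := Unitary.coe_star_mul_self g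
      have h3 : (star (g : A) - 1) * x = -(star (x : A) * ((g : A) - 1)) := by
        rw [hx, star_add, star_one, sub_mul, add_mul, mul_add, mul_sub, h1]
        noncomm_ring
      refine skewAdjoint.mem_iff.2 ?_
      rw [← hx, Ring.inverse_unit, star_mul, ← Units.coe_star, star_inv, star_sub, star_one,
        ← (star x).isUnit.mul_right_inj, ← x.isUnit.mul_left_inj]
      rw [Units.mul_inv_cancel_left, h3]
      simp [mul_assoc]
    · rw [Ring.inverse_non_unit _ h, mul_zero]
      exact Submodule.zero_mem _⟩

theorem isUnit_two : IsUnit (2 : A) := by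
  have h := (IsUnit.mk0 (2 : ℂ) two_ne_zero).map (algebraMap ℂ A)
  rwa [map_ofNat] at h

/-- With `b` half of a skew-adjoint element, `cayleyInv a * (1 - b) = 1 + b`. -/
theorem cayleyInv_mul (a : Skew A) :
    (cayleyInv a : A) * (1 - (2⁻¹ : ℝ) • (a : A)) = 1 + (2⁻¹ : ℝ) • (a : A) := by
  change (1 + (2⁻¹ : ℝ) • (a : A)) * Ring.inverse (1 - (2⁻¹ : ℝ) • (a : A)) * _ = _
  rw [mul_assoc, Ring.inverse_mul_cancel _ (isUnit_one_sub_of_skew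
    (by rw [star_smul, star_skew, smul_neg]; simp)), mul_one]

theorem cayley_mul {g : unitary A} (hg : IsUnit ((g : A) + 1)) :
    (2⁻¹ : ℝ) • (cayley g : A) * ((g : A) + 1) = g - 1 := by
  change (2⁻¹ : ℝ) • ((2 : ℝ) • (((g : A) - 1) * Ring.inverse ((g : A) + 1))) * _ = _
  rw [smul_smul, inv_mul_cancel₀ two_ne_zero, one_smul, mul_assoc, Ring.inverse_mul_cancel _ hg,
    mul_one]

theorem cayleyInv_add_one_mul (a : Skew A) :
    ((cayleyInv a : A) + 1) * (1 - (2⁻¹ : ℝ) • (a : A)) = 2 := by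
  rw [add_mul, cayleyInv_mul, one_mul, ← one_add_one_eq_two (R := A)]
  abel

theorem isUnit_cayleyInv_add_one (a : Skew A) : IsUnit ((cayleyInv a : A) + 1) := by
  have h : IsUnit (1 - (2⁻¹ : ℝ) • (a : A)) := isUnit_one_sub_of_skew
    (by rw [star_smul, star_skew, smul_neg]; simp)
  rw [← h.mul_right_iff, cayleyInv_add_one_mul]
  exact isUnit_two

/-- The Cayley chart of the unitary group at the identity. -/
noncomputable def cayleyChart : OpenPartialHomeomorph (unitary A) (Skew A) where
  toFun := cayley
  invFun := cayleyInv
  source := {g | IsUnit ((g : A) + 1)}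
  target := Set.univ
  map_source' _ _ := Set.mem_univ _
  map_target' a _ := isUnit_cayleyInv_add_one a
  left_inv' g hg := by
    have hu : IsUnit (1 - (2⁻¹ : ℝ) • (cayley g : A)) := isUnit_one_sub_of_skew
      (by rw [star_smul, star_skew, smul_neg]; simp)
    have h := cayley_mul hg
    have h1 := cayleyInv_mul (cayley g)
    set b : A := (2⁻¹ : ℝ) • (cayley g : A)
    have h2 : (1 - b) * ((g : A) + 1) = 2 := by
      rw [sub_mul, h, one_mul, ← one_add_one_eq_two (R := A)]
      abel
    have h3 : (1 + b) * ((g : A) + 1) = 2 * g := by rw [add_mul, h]; noncomm_ring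
    ext
    rw [← (isUnit_two (A := A)).mul_left_inj, ← h2, ← mul_assoc, h1, h3, h2]
    noncomm_ring
  right_inv' a _ := by
    have hu := isUnit_cayleyInv_add_one a
    have h := cayley_mul hu
    have h1 := cayleyInv_mul a
    have h2 : (2⁻¹ : ℝ) • (cayley (cayleyInv a) : A) * 2 = (2⁻¹ : ℝ) • (a : A) * 2 := by
      rw [← cayleyInv_add_one_mul a, ← mul_assoc, h, ← mul_assoc, sub_mul, h1, mul_assoc,
        cayleyInv_add_one_mul]
      noncomm_ring
    rw [isUnit_two.mul_left_inj] at h2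
    ext
    exact smul_right_injective A (by norm_num : (2⁻¹ : ℝ) ≠ 0) h2
  open_source := Units.isOpen.preimage (by fun_prop)
  open_target := isOpen_univ
  continuousOn_toFun := by
    refine Topology.IsInducing.subtypeVal.continuousOn_iff.2 ?_
    refine ContinuousOn.const_smul (ContinuousOn.mul (by fun_prop) ?_) _
    intro g hg
    obtain ⟨x, hx⟩ := id hg
    have h : ContinuousAt Ring.inverse ((g : A) + 1) := hx ▸ NormedRing.inverse_continuousAt x
    exact (ContinuousAt.comp (f := fun g : unitary A => (g : A) + 1) h
      (by fun_prop)).continuousWithinAt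
  continuousOn_invFun := by
    refine Topology.IsInducing.subtypeVal.continuousOn_iff.2 ?_
    refine ContinuousOn.mul (by fun_prop) ?_
    intro a _
    obtain ⟨x, hx⟩ := isUnit_one_sub_of_skew (A := A) (b := (2⁻¹ : ℝ) • (a : A))
      (by rw [star_smul, star_skew, smul_neg]; simp)
    have h : ContinuousAt Ring.inverse (1 - (2⁻¹ : ℝ) • (a : A)) :=
      hx ▸ NormedRing.inverse_continuousAt x
    exact (ContinuousAt.comp (f := fun a : Skew A => 1 - (2⁻¹ : ℝ) • (a : A)) h
      (by fun_prop)).continuousWithinAt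

/-- The structure of charted space of the unitary group: the left translates of the Cayley chart. -/
noncomputable instance : ChartedSpace (Skew A) (unitary A) where
  atlas := Set.range fun g : unitary A =>
    (Homeomorph.mulLeft g⁻¹).toOpenPartialHomeomorph.trans cayleyChart
  chartAt g := (Homeomorph.mulLeft g⁻¹).toOpenPartialHomeomorph.trans cayleyChart
  mem_chart_source g := by
    have h : IsUnit (((g⁻¹ * g : unitary A) : A) + 1) := by
      rw [inv_mul_cancel, OneMemClass.coe_one, one_add_one_eq_two]
      exact isUnit_two
    exact ⟨Set.mem_univ _, h⟩
  chart_mem_atlas g := ⟨g, rfl⟩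

end Unitary

/-! ### Homogeneous, symmetric and complex symmetric `G`-spaces -/

section GSpace

/-- A subgroup `K` of a Banach Lie group `G` is a Lie subgroup if it is a split submanifold: around
each of its points there is a chart of `G` in which `K` is a closed complemented subspace. -/
def IsLieSubgroup (EG : Type*) [NormedAddCommGroup EG] [NormedSpace ℝ EG]
    {G : Type*} [Group G] [TopologicalSpace G] [ChartedSpace EG G] (K : Subgroup G) : Prop :=
  ∀ k ∈ K, ∃ c ∈ IsManifold.maximalAtlas 𝓘(ℝ, EG) ∞ G, k ∈ c.source ∧
    ∃ F : Submodule ℝ EG, F.ClosedComplemented ∧ ∀ g ∈ c.source, (g ∈ K ↔ c g ∈ F)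

/-- `(M, G)` is a homogeneous `G`-space: `G` is a connected Hausdorff Banach Lie group, `M` is a
connected Hausdorff smooth Banach manifold, the action is smooth and transitive, and the isotropy
groups are Lie subgroups. -/
structure IsHomogeneousGSpace (EG : Type*) [NormedAddCommGroup EG] [NormedSpace ℝ EG]
    (G : Type*) [Group G] [TopologicalSpace G] [ChartedSpace EG G]
    (EM : Type*) [NormedAddCommGroup EM] [NormedSpace ℝ EM]
    (M : Type*) [TopologicalSpace M] [ChartedSpace EM M] [MulAction G M] : Prop where
  completeSpace_group : CompleteSpace EG
  lieGroup : LieGroup 𝓘(ℝ, EG) ∞ G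
  t2Space_group : T2Space G
  connectedSpace_group : ConnectedSpace G
  completeSpace : CompleteSpace EM
  isManifold : IsManifold 𝓘(ℝ, EM) ∞ M
  t2Space : T2Space M
  connectedSpace : ConnectedSpace M
  contMDiff_smul : ContMDiff (𝓘(ℝ, EG).prod 𝓘(ℝ, EM)) 𝓘(ℝ, EM) ∞ (fun p : G × M => p.1 • p.2)
  isPretransitive : MulAction.IsPretransitive G M
  isLieSubgroup_stabilizer : ∀ x : M, IsLieSubgroup EG (MulAction.stabilizer G x)

/-- `(M, G, s)` is a symmetric `G`-space with base point `o` and associated automorphism `σ` of `G`: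
`s` is an involutive diffeomorphism of `M` with the isolated fixed point `o`, the symmetries
`s_x = g ∘ s ∘ g⁻¹` at `x = g • o` do not depend on the choice of `g`, and `σ` is an involutive
automorphism of the Lie group `G` with `s (g • x) = σ g • s x` (so that `σ g • o = s (g • o)`). -/
structure IsSymmetricGSpace (EG : Type*) [NormedAddCommGroup EG] [NormedSpace ℝ EG]
    {G : Type*} [Group G] [TopologicalSpace G] [ChartedSpace EG G]
    (EM : Type*) [NormedAddCommGroup EM] [NormedSpace ℝ EM]
    {M : Type*} [TopologicalSpace M] [ChartedSpace EM M] [MulAction G M]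
    (s : M → M) (o : M) (σ : G ≃* G) : Prop extends IsHomogeneousGSpace EG G EM M where
  involutive : Function.Involutive s
  contMDiff : ContMDiff 𝓘(ℝ, EM) 𝓘(ℝ, EM) ∞ s
  fixed : s o = o
  isolated : ∀ᶠ x in 𝓝 o, s x = x → x = o
  symmetry_eq : ∀ g h : G, g • o = h • o → ∀ x : M, g • s (g⁻¹ • x) = h • s (h⁻¹ • x)
  involutive_aut : Function.Involutive σ
  contMDiff_aut : ContMDiff 𝓘(ℝ, EG) 𝓘(ℝ, EG) ∞ σ
  map_smul : ∀ (g : G) (x : M), s (g • x) = σ g • s x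

/-- A complex symmetric `G`-space: a symmetric `G`-space which is a complex Banach manifold and whose
symmetries `s_x`, `x = g • o`, and automorphisms `x ↦ g • x` are biholomorphic. (The inverses are
maps of the same kind, so it is enough that they are holomorphic.) -/
structure IsComplexSymmetricGSpace (EG : Type*) [NormedAddCommGroup EG] [NormedSpace ℝ EG]
    {G : Type*} [Group G] [TopologicalSpace G] [ChartedSpace EG G]
    (EM : Type*) [NormedAddCommGroup EM] [NormedSpace ℂ EM]
    {M : Type*} [TopologicalSpace M] [ChartedSpace EM M] [MulAction G M]
    (s : M → M) (o : M) (σ : G ≃* G) : Prop extends IsSymmetricGSpace EG EM s o σ where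
  isManifold_complex : IsManifold 𝓘(ℂ, EM) ω M
  holomorphic_symmetry : ∀ g : G, ContMDiff 𝓘(ℂ, EM) 𝓘(ℂ, EM) ω (fun x : M => g • s (g⁻¹ • x))
  holomorphic_smul : ∀ g : G, ContMDiff 𝓘(ℂ, EM) 𝓘(ℂ, EM) ω (fun x : M => g • x)

end GSpace

/-! ### The unitary group acting on the projective space -/

section Action

variable {H : Type u} [NormedAddCommGroup H] [InnerProductSpace ℂ H] [CompleteSpace H]

variable (H) in
/-- The group `U(H)` of unitary operators of `H`, with the norm topology. -/
abbrev U : Type u := unitary (H →L[ℂ] H)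

variable (H) in
/-- The real Banach space `𝔲(H)` of bounded skew-adjoint operators, the model space of `U(H)` and its
tangent space at the identity. -/
abbrev LieU : Type u := Skew (H →L[ℂ] H)

theorem Ad_mem (g : U H) (a : LieU H) :
    (g : H →L[ℂ] H) * a * star (g : H →L[ℂ] H) ∈ skewAdjoint.submodule ℝ (H →L[ℂ] H) := by
  refine skewAdjoint.mem_iff.2 ?_
  rw [star_mul, star_mul, star_star, star_skew, neg_mul, mul_neg, mul_assoc]

/-- The adjoint action `A ↦ g A g⁻¹` of `U(H)` on `𝔲(H)`. -/
noncomputable def AdL (g : U H) : LieU H →L[ℝ] LieU H where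
  toFun a := ⟨g * a * star (g : H →L[ℂ] H), Ad_mem g a⟩
  map_add' a b := by
    ext1
    simp only [Submodule.coe_add, mul_add, add_mul]
  map_smul' r a := by
    ext1
    simp only [Submodule.coe_smul, mul_smul_comm, smul_mul_assoc, RingHom.id_apply]
  cont := by fun_prop

/-- The ray of a unit vector. -/
noncomputable def rayOf (χ : H) (hχ : ‖χ‖ = 1) : ℙ ℂ H := Projectivization.mk ℂ χ (by rintro rfl; simp at hχ)

/-- The one-dimensional orthogonal projection `P_χ` onto the ray of `χ`. -/
noncomputable def rayProj (χ : H) : H →L[ℂ] H := (ℂ ∙ χ).starProjection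

/-- The unitary operator `S = 1 - 2 P_χ`. -/
noncomputable def reflS (χ : H) : U H :=
  ⟨1 - (2 : ℂ) • rayProj χ, by
    have h1 : rayProj χ * rayProj χ = rayProj χ := (Submodule.isIdempotentElem_starProjection (ℂ ∙ χ)).eq
    have h2 : star (rayProj χ) = rayProj χ := isSelfAdjoint_starProjection (ℂ ∙ χ)
    have h3 : star (1 - (2 : ℂ) • rayProj χ) = 1 - (2 : ℂ) • rayProj χ := by
      rw [star_sub, star_one, star_smul, h2]
      simp
    rw [Unitary.mem_iff, h3, and_self, sub_mul, mul_sub, mul_sub, smul_mul_smul_comm, h1]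
    simp only [mul_one, one_mul]
    module⟩

/-- The commutant `𝔥` of `P_χ` in `𝔲(H)`. -/
noncomputable def commutant (χ : H) : Submodule ℝ (LieU H) where
  carrier := {a | rayProj χ * (a : H →L[ℂ] H) = a * rayProj χ}
  add_mem' {a b} ha hb := by
    simp only [Set.mem_ofPred_eq, Submodule.coe_add, mul_add, add_mul] at ha hb ⊢
    rw [ha, hb]
  zero_mem' := by simp
  smul_mem' r a ha := by
    simp only [Set.mem_ofPred_eq, Submodule.coe_smul, mul_smul_comm, smul_mul_assoc] at ha ⊢
    rw [ha]

/-- The space `𝔪` of the elements of `𝔲(H)` that anticommute with `S = 1 - 2 P_χ`. -/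
noncomputable def anticommutant (χ : H) : Submodule ℝ (LieU H) where
  carrier := {a | (reflS χ : H →L[ℂ] H) * (a : H →L[ℂ] H) = -(a * reflS χ)}
  add_mem' {a b} ha hb := by
    simp only [Set.mem_ofPred_eq, Submodule.coe_add, mul_add, add_mul] at ha hb ⊢
    rw [ha, hb, neg_add]
  zero_mem' := by simp
  smul_mem' r a ha := by
    simp only [Set.mem_ofPred_eq, Submodule.coe_smul, mul_smul_comm, smul_mul_assoc] at ha ⊢
    rw [ha, smul_neg]

/-- `t` is the trace of the operator `T`: for every orthonormal basis `b` of `H`, the family of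
diagonal entries `⟪b i, T (b i)⟫` is (unconditionally) summable with sum `t`. -/
def HasTrace (T : H →L[ℂ] H) (t : ℂ) : Prop :=
  ∀ (ι : Type u) (b : HilbertBasis ι ℂ H), HasSum (fun i => ⟪b i, T (b i)⟫_ℂ) t

variable [Nontrivial H]

/-- The differential at the identity of the orbit map `g ↦ g • x` of `U(H)`. -/
noncomputable def orbitDeriv (x : ℙ ℂ H) : LieU H →L[ℝ] TangentSpace 𝓘(ℝ, PModel H) x :=
  mfderiv 𝓘(ℝ, LieU H) 𝓘(ℝ, PModel H) (fun g : U H => g • x) 1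

/-- The complex structure `J`, multiplication by `i`, of the tangent space of the projective space
at `x`. -/
noncomputable def complexStructure (x : ℙ ℂ H) :
    TangentSpace 𝓘(ℝ, PModel H) x →L[ℝ] TangentSpace 𝓘(ℝ, PModel H) x :=
  Complex.I • ContinuousLinearMap.id ℝ (PModel H)

variable (H) in
/-- Smooth Riemannian metrics on the projective space. -/
abbrev ProjMetric : Type u :=
  Bundle.ContMDiffRiemannianMetric 𝓘(ℝ, PModel H) ∞ (PModel H)
    (fun x : ℙ ℂ H => TangentSpace 𝓘(ℝ, PModel H) x)

/-- The differential `T b_φ` of the affine chart `b_φ` at the ray of `φ`. -/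
noncomputable def affineDeriv (φ : H) (hφ : ‖φ‖ = 1) :
    TangentSpace 𝓘(ℝ, PModel H) (rayOf φ hφ) →L[ℝ] (ℂ ∙ φ)ᗮ :=
  mfderiv 𝓘(ℝ, PModel H) 𝓘(ℝ, (ℂ ∙ φ)ᗮ) (affineCoord φ) (rayOf φ hφ)

/-- `g` is the Fubini-Study metric with constant `κ`: at the ray of any unit vector `φ` it is
`g(v, w) = 2 κ Re ⟪T b_φ v, T b_φ w⟫`. -/
def IsFubiniStudy (κ : ℝ) (g : ProjMetric H) : Prop :=
  ∀ (φ : H) (hφ : ‖φ‖ = 1) (v w : TangentSpace 𝓘(ℝ, PModel H) (rayOf φ hφ)),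
    g.inner (rayOf φ hφ) v w = 2 * κ * (⟪affineDeriv φ hφ v, affineDeriv φ hφ w⟫_ℂ).re

/-- `g` is invariant under the action of `U(H)`. -/
def IsInvariantMetric (g : ProjMetric H) : Prop :=
  ∀ (u : U H) (x : ℙ ℂ H) (v w : TangentSpace 𝓘(ℝ, PModel H) x),
    g.inner (u • x) (mfderiv 𝓘(ℝ, PModel H) 𝓘(ℝ, PModel H) (fun y : ℙ ℂ H => u • y) x v)
      (mfderiv 𝓘(ℝ, PModel H) 𝓘(ℝ, PModel H) (fun y : ℙ ℂ H => u • y) x w) = g.inner x v w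

/-- `g` is the metric induced by the scalar product `β` on `𝔪`: it is invariant, and at the ray of
`χ` it is `β` transported by the differential of the orbit map. -/
def IsInducedMetric (χ : H) (hχ : ‖χ‖ = 1)
    (β : anticommutant χ →L[ℝ] anticommutant χ →L[ℝ] ℝ) (g : ProjMetric H) : Prop :=
  IsInvariantMetric g ∧ ∀ a b : anticommutant χ,
    g.inner (rayOf χ hχ) (orbitDeriv (rayOf χ hχ) a) (orbitDeriv (rayOf χ hχ) b) = β a b

end Action

end ProjectiveHilbert

open ProjectiveHilbert

/-! The proof rests on the embedding `projOf` of rays as rank one projections, x ↦ P_x, which is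
injective, smooth and equivariant: P_{gx} = g P_x g*. It makes P(H) Hausdorff, and it shows that g
fixes the ray of χ iff g commutes with P_χ, hence iff g commutes with S = 1 - 2 P_χ.

Group elements that move rays are products of reflections. By `reflS_add_apply` the reflection along
φ + ψ sends φ to -ψ when φ, ψ have equal norm and real scalar product. This gives transitivity and,
composed with the reflection along φ, a continuous local section of the orbit map
(`exists_local_section`), so that this map is open. U(H) is connected because every g is joined to 1
through i R, where R is a symmetry built from the sign of the imaginary part of g
(`exists_symmetry_mul_nonneg`); P(H) is then connected as an orbit.

The Cayley transform is a rational function, so it preserves commutation with P_χ: its translates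
straighten the isotropy group to the subspace 𝔥 (`cayley_mem_commutant_iff`). Ad S is an involution
whose eigenspaces are 𝔥 and 𝔪. An A in 𝔪 is off-diagonal, A = |Aχ⟩⟨χ| - |χ⟩⟨Aχ|
(`apply_of_mem_anticommutant`). Hence A ↦ Aχ is a bijection of 𝔪 onto χ^⊥, it is the differential of
the orbit map in the chart b_χ, and Tr(AB) = -2 Re ⟨Aχ, Bχ⟩.

For the metric, the chart b_φ varies with the point, so smoothness is not visible in its defining
formula. The form 2κ Re ⟨dP(v) φ, dP(w) φ⟩ is used instead. It is smooth and invariant because P is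
smooth and equivariant, and it is the Fubini–Study form because dP(v) φ = T b_φ(v)
(`projDeriv_apply_self`). Uniqueness follows from transitivity. -/

namespace ProjectiveHilbert

universe u

/-! ### The unitary group of a C*-algebra as a Banach Lie group -/

section UnitaryManifold

variable {A : Type u} [CStarAlgebra A]

theorem contDiffAt_ringInverse_comp {E : Type*} [NormedAddCommGroup E] [NormedSpace ℝ E]
    {n : ℕ∞ω} {f : E → A} {x : E} (hf : ContDiffAt ℝ n f x) (hx : IsUnit (f x)) :
    ContDiffAt ℝ n (fun y => Ring.inverse (f y)) x := by
  obtain ⟨y, hy⟩ := hx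
  exact ContDiffAt.comp x (hy ▸ contDiffAt_ringInverse ℝ y) hf

theorem isUnit_one_sub_half (a : Skew A) : IsUnit (1 - (2⁻¹ : ℝ) • (a : A)) :=
  isUnit_one_sub_of_skew (by rw [star_smul, star_skew, smul_neg]; simp)

theorem contDiff_coe_cayleyInv {n : ℕ∞ω} : ContDiff ℝ n (fun a : Skew A => (cayleyInv a : A)) := by
  have h : ContDiff ℝ n (fun a : Skew A => (a : A)) := (skewAdjoint.submodule ℝ A).subtypeL.contDiff
  refine ContDiff.mul (contDiff_const.add (h.const_smul _)) (contDiff_iff_contDiffAt.2 fun a => ?_)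
  exact contDiffAt_ringInverse_comp (contDiff_const.sub (h.const_smul _)).contDiffAt
    (isUnit_one_sub_half a)

variable (A) in
/-- The projection `x ↦ (x - x*) / 2` onto the skew-adjoint part. -/
noncomputable def skewPart : A →L[ℝ] Skew A :=
  ((2⁻¹ : ℝ) • (ContinuousLinearMap.id ℝ A - (starL' ℝ : A ≃L[ℝ] A))).codRestrict
    (skewAdjoint.submodule ℝ A) fun x => skewAdjoint.mem_iff.2 (by
      simp only [smul_apply, sub_apply,
        ContinuousLinearMap.id_apply, ContinuousLinearEquiv.coe_coe, starL'_apply, star_smul,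
        star_sub, star_star, star_trivial]
      rw [← smul_neg, neg_sub])

theorem skewPart_coe (a : Skew A) : skewPart A (a : A) = a := by
  ext1
  change (2⁻¹ : ℝ) • ((a : A) - star (a : A)) = a
  rw [star_skew, sub_neg_eq_add, ← two_smul ℝ (a : A), smul_smul]
  norm_num

/-- The formula of the Cayley transform on the whole algebra, followed by the projection onto the
skew-adjoint part. -/
noncomputable def cayleyExt (x : A) : Skew A :=
  skewPart A ((2 : ℝ) • ((x - 1) * Ring.inverse (x + 1)))

theorem cayleyExt_coe (g : unitary A) : cayleyExt (g : A) = cayley g :=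
  skewPart_coe (cayley g)

/-- Differentiability is tested on open subsets of the algebra, where the Cayley formula need not be
skew-adjoint; the projection in `cayleyExt` repairs this without changing the values at unitary
elements. -/
theorem contDiffAt_cayleyExt {n : ℕ∞ω} {x : A} (hx : IsUnit (x + 1)) :
    ContDiffAt ℝ n (cayleyExt : A → Skew A) x := by
  refine (skewPart A).contDiff.contDiffAt.comp x (ContDiffAt.const_smul _ ?_)
  exact (contDiffAt_id.sub contDiffAt_const).mul
    (contDiffAt_ringInverse_comp (contDiffAt_id.add contDiffAt_const) hx)

theorem contDiffOn_cayley_transition {n : ℕ∞ω} {c c' : OpenPartialHomeomorph (unitary A) (Skew A)}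
    (hc : c ∈ atlas (Skew A) (unitary A)) (hc' : c' ∈ atlas (Skew A) (unitary A)) :
    ContDiffOn ℝ n (c.symm.trans c') (c.symm.trans c').source := by
  obtain ⟨g, rfl⟩ := hc
  obtain ⟨h, rfl⟩ := hc'
  intro a ha
  refine ContDiffAt.contDiffWithinAt ?_
  have hu : IsUnit (((h⁻¹ * (g * cayleyInv a) : unitary A) : A) + 1) := by
    rw [← inv_inv g]
    exact ha.2.2
  have : ContDiffAt ℝ n (fun a : Skew A => cayleyExt (((h⁻¹ : unitary A) : A) * ((g : A) *
      (cayleyInv a : A)))) a := by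
    refine ContDiffAt.comp a (g := cayleyExt) (contDiffAt_cayleyExt hu) ?_
    exact contDiffAt_const.mul (contDiffAt_const.mul contDiff_coe_cayleyInv.contDiffAt)
  refine this.congr_of_eventuallyEq (Filter.Eventually.of_forall fun b => ?_)
  have e := cayleyExt_coe (h⁻¹ * (g * cayleyInv b))
  rw [Submonoid.coe_mul, Submonoid.coe_mul] at e
  beta_reduce
  rw [e]
  exact congrArg (fun k : unitary A => cayley (h⁻¹ * (k * cayleyInv b))) (inv_inv g)

instance isManifold_unitary {n : ℕ∞ω} : IsManifold 𝓘(ℝ, Skew A) n (unitary A) :=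
  isManifold_of_contDiffOn _ _ _ fun c c' hc hc' => by
    simpa using contDiffOn_cayley_transition hc hc'

theorem chartAt_unitary_symm_coe (g : unitary A) (a : Skew A) :
    (((chartAt (Skew A) g).symm a : unitary A) : A) = g * cayleyInv a := by
  change (((g⁻¹)⁻¹ * cayleyInv a : unitary A) : A) = _
  rw [inv_inv, Submonoid.coe_mul]

theorem chartAt_unitary_apply (g h : unitary A) : chartAt (Skew A) g h = cayley (g⁻¹ * h) := rfl

theorem contMDiff_coe_unitary {n : ℕ∞ω} :
    ContMDiff 𝓘(ℝ, Skew A) 𝓘(ℝ, A) n (fun g : unitary A => (g : A)) := by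
  intro g
  rw [contMDiffAt_iff]
  refine ⟨continuous_subtype_val.continuousAt, ?_⟩
  have : ContDiff ℝ n fun a : Skew A => (g : A) * cayleyInv a :=
    contDiff_const.mul contDiff_coe_cayleyInv
  refine (this.contDiffWithinAt).congr_of_eventuallyEq_of_mem
    (Filter.Eventually.of_forall fun a => ?_) (by simp)
  exact chartAt_unitary_symm_coe g a

section

variable {E' : Type*} [NormedAddCommGroup E'] [NormedSpace ℝ E'] {H' : Type*} [TopologicalSpace H']
  {I : ModelWithCorners ℝ E' H'} {M : Type*} [TopologicalSpace M] [ChartedSpace H' M]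

/-- The unitary group behaves as an embedded submanifold: the chart at `f x` is the restriction of z
↦ `cayleyExt` ((f x)⁻¹ z), which is smooth on a neighbourhood of `f x` in the algebra. Smoothness of
products and inverses thus reduces to the ambient operations. -/
theorem contMDiffAt_unitary_of_coe {n : ℕ∞ω} {f : M → unitary A} {x : M}
    (hf : ContMDiffAt I 𝓘(ℝ, A) n (fun y => (f y : A)) x) : ContMDiffAt I 𝓘(ℝ, Skew A) n f x := by
  rw [contMDiffAt_iff_target]
  refine ⟨Topology.IsInducing.subtypeVal.continuousAt_iff.2 hf.continuousAt, ?_⟩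
  have h1 : ContMDiffAt I 𝓘(ℝ, A) n (fun y => ((f x)⁻¹ : unitary A) * (f y : A)) x :=
    ContMDiffAt.comp x (g := fun z : A => (((f x)⁻¹ : unitary A) : A) * z)
      (ContDiff.contMDiff (contDiff_const.mul contDiff_id)).contMDiffAt hf
  have h2 : ContMDiffAt 𝓘(ℝ, A) 𝓘(ℝ, Skew A) n cayleyExt (((f x)⁻¹ : unitary A) * (f x : A)) := by
    refine (contDiffAt_cayleyExt ?_).contMDiffAt
    rw [← Submonoid.coe_mul, inv_mul_cancel, OneMemClass.coe_one, one_add_one_eq_two]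
    exact isUnit_two
  refine (ContMDiffAt.comp x h2 h1).congr_of_eventuallyEq (Filter.Eventually.of_forall fun y => ?_)
  have e := cayleyExt_coe ((f x)⁻¹ * f y)
  rw [Submonoid.coe_mul] at e
  simp only [Function.comp_apply, e]
  rfl

theorem contMDiff_unitary_of_coe {n : ℕ∞ω} {f : M → unitary A}
    (hf : ContMDiff I 𝓘(ℝ, A) n (fun y => (f y : A))) : ContMDiff I 𝓘(ℝ, Skew A) n f :=
  fun x => contMDiffAt_unitary_of_coe (hf x)

end

instance lieGroup_unitary {n : ℕ∞ω} : LieGroup 𝓘(ℝ, Skew A) n (unitary A) where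
  contMDiff_mul := by
    refine contMDiff_unitary_of_coe ?_
    have h1 : ContMDiff (𝓘(ℝ, Skew A).prod 𝓘(ℝ, Skew A)) 𝓘(ℝ, A) n
        (fun p : unitary A × unitary A => (p.1 : A)) := contMDiff_coe_unitary.comp contMDiff_fst
    have h2 : ContMDiff (𝓘(ℝ, Skew A).prod 𝓘(ℝ, Skew A)) 𝓘(ℝ, A) n
        (fun p : unitary A × unitary A => (p.2 : A)) := contMDiff_coe_unitary.comp contMDiff_snd
    exact ContMDiff.comp (g := fun q : A × A => q.1 * q.2)
      (ContDiff.contMDiff (contDiff_fst.mul contDiff_snd)) (h1.prodMk_space h2)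
  contMDiff_inv := by
    refine contMDiff_unitary_of_coe ?_
    exact ContMDiff.comp (g := fun z : A => star z)
      (ContDiff.contMDiff (starL' ℝ : A ≃L[ℝ] A).contDiff) contMDiff_coe_unitary

theorem cayleyInv_zero : cayleyInv (0 : Skew A) = 1 := by
  ext
  have := cayleyInv_mul (0 : Skew A)
  simpa using this

/-- Differentiating the identity `cayleyInv_mul` at 0 gives D a - a/2 = a/2. The factor 1/2 in the
Cayley transform is what makes the differential the plain inclusion. -/
theorem hasFDerivAt_coe_cayleyInv_zero :
    HasFDerivAt (fun a : Skew A => (cayleyInv a : A)) (skewAdjoint.submodule ℝ A).subtypeL 0 := by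
  have h := ((contDiff_coe_cayleyInv (A := A) (n := 1)).differentiable one_ne_zero 0).hasFDerivAt
  set D := fderiv ℝ (fun a : Skew A => (cayleyInv a : A)) 0
  set j := (skewAdjoint.submodule ℝ A).subtypeL
  have hj : HasFDerivAt (fun a : Skew A => (2⁻¹ : ℝ) • (a : A)) ((2⁻¹ : ℝ) • j) 0 :=
    j.hasFDerivAt.const_smul _
  have h1 := h.mul' (hj.const_sub (1 : A))
  have h2 := hj.const_add (1 : A)
  have h3 := (h1.congr_of_eventuallyEq
    (Filter.Eventually.of_forall fun a => (cayleyInv_mul a).symm)).unique h2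
  suffices e : j = D from e ▸ h
  ext a
  have h4 := congrArg (fun T : Skew A →L[ℝ] A => T a) h3
  simp only [cayleyInv_zero, OneMemClass.coe_one, one_smul, add_apply, neg_apply, smul_apply,
    ZeroMemClass.coe_zero, smul_zero, sub_zero, MulOpposite.op_one] at h4
  rw [neg_add_eq_iff_eq_add, ← add_smul] at h4
  rw [h4]
  norm_num

theorem hasMFDerivAt_coe_unitary_one :
    HasMFDerivAt 𝓘(ℝ, Skew A) 𝓘(ℝ, A) (fun g : unitary A => (g : A)) 1
      (skewAdjoint.submodule ℝ A).subtypeL := by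
  refine ⟨continuous_subtype_val.continuousAt, ?_⟩
  have e : extChartAt 𝓘(ℝ, Skew A) (1 : unitary A) 1 = 0 := by
    change cayley ((1 : unitary A)⁻¹ * 1) = 0
    ext1
    simp [cayley]
  rw [e]
  refine HasFDerivAt.hasFDerivWithinAt ?_
  refine hasFDerivAt_coe_cayleyInv_zero.congr_of_eventuallyEq (Filter.Eventually.of_forall fun a => ?_)
  exact (chartAt_unitary_symm_coe 1 a).trans (one_mul _)

end UnitaryManifold

/-! ### Connectedness of U(H) -/

section UnitaryConnected

variable {H : Type u} [NormedAddCommGroup H] [InnerProductSpace ℂ H] [CompleteSpace H]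

/-- ‖Wx - x‖² = 2‖x‖² - 2 Re ⟨x, Wx⟩ ≤ 2‖x‖², so the norm is at most √2. Distance less than 2 is
what `Unitary.joined` requires. -/
theorem norm_sub_one_lt_two_of_nonneg (W : U H) (h : 0 ≤ (W : H →L[ℂ] H) + star (W : H →L[ℂ] H)) :
    ‖(W : H →L[ℂ] H) - 1‖ < 2 := by
  have h2 : ‖(W : H →L[ℂ] H) - 1‖ ≤ √2 := by
    refine ContinuousLinearMap.opNorm_le_bound _ (Real.sqrt_nonneg _) fun x => ?_
    have h0 := (ContinuousLinearMap.nonneg_iff_isPositive _).1 h |>.re_inner_nonneg_right x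
    rw [add_apply, inner_add_right, ContinuousLinearMap.star_eq_adjoint,
      ContinuousLinearMap.adjoint_inner_right, map_add, ← inner_conj_symm ((W : H →L[ℂ] H) x),
      RCLike.conj_re] at h0
    have h1 := norm_sub_sq (𝕜 := ℂ) x ((W : H →L[ℂ] H) x)
    rw [Unitary.norm_map, norm_sub_rev] at h1
    refine abs_le_of_sq_le_sq' ?_ (by positivity) |>.2
    rw [mul_pow, Real.sq_sqrt zero_le_two, sub_apply, one_apply_eq_self, h1]
    linarith
  refine h2.trans_lt ?_
  rw [Real.sqrt_lt' two_pos]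
  norm_num

/-- The kernel of T is invariant under V and under V*, hence reduces V. -/
theorem commute_starProjection_ker {T V : H →L[ℂ] H} (h : Commute T V) (h' : Commute T (star V)) :
    Commute V T.ker.starProjection := by
  set Q := T.ker.starProjection with hQ
  have hT : ∀ x, T (Q x) = 0 := fun x => T.ker.starProjection_apply_mem x
  have key : ∀ W : H →L[ℂ] H, Commute T W → Q * (W * Q) = W * Q := by
    intro W hW
    ext x
    refine Submodule.starProjection_eq_self_iff.2 ?_
    have := congrArg (fun S : H →L[ℂ] H => S (Q x)) hW.eq
    simpa [hT] using this
  have hs : star Q = Q := isSelfAdjoint_starProjection _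
  have h2 := congrArg star (key _ h')
  simp only [star_mul, star_star, hs, mul_assoc] at h2
  exact ((key V h).symm.trans h2)

/-- R plays the role of the sign of B = i(g* - g), twice the imaginary part of g. It is -1 on the
kernel of B⁺, where B = -B⁻, and 1 on the orthogonal complement; hence B R = B⁺ + B⁻. Using a kernel
projection avoids a discontinuous functional calculus. -/
theorem exists_symmetry_mul_nonneg (g : U H) : ∃ R : H →L[ℂ] H, star R = R ∧ R * R = 1 ∧
    Commute (g : H →L[ℂ] H) R ∧
      0 ≤ (Complex.I • (star (g : H →L[ℂ] H) - (g : H →L[ℂ] H))) * R := by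
  set V := (g : H →L[ℂ] H)
  set B : H →L[ℂ] H := Complex.I • (star V - V) with hB
  have hsa : IsSelfAdjoint B := by
    rw [isSelfAdjoint_iff, hB, star_smul, star_sub, star_star, Complex.star_def, Complex.conj_I]
    module
  have hVV : Commute V (star V) :=
    (Unitary.mul_star_self_of_mem g.2).trans (Unitary.star_mul_self_of_mem g.2).symm
  have hBV : Commute B V := (hVV.symm.sub_left (Commute.refl V)).smul_left _
  have hBV' : Commute B (star V) := ((Commute.refl _).sub_left hVV).smul_left _
  have hp : Commute (B⁺) V := hBV.cfcₙ_real _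
  have hp' : Commute (B⁺) (star V) := hBV'.cfcₙ_real _
  set Q := (B⁺).ker.starProjection with hQ
  have hVQ : Commute V Q := commute_starProjection_ker hp hp'
  have hQs : star Q = Q := isSelfAdjoint_starProjection _
  have hQQ : Q * Q = Q := (Submodule.isIdempotentElem_starProjection _).eq
  have h1 : B⁺ * Q = 0 := by
    ext x
    exact (B⁺).ker.starProjection_apply_mem x
  have h2 : Q * B⁻ = B⁻ := by
    ext x
    refine Submodule.starProjection_eq_self_iff.2 ?_
    exact congrArg (fun S : H →L[ℂ] H => S x) (CFC.posPart_mul_negPart B)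
  have h3 : B⁻ * Q = B⁻ := by
    have := congrArg star h2
    rwa [star_mul, hQs, (CFC.negPart_nonneg B).isSelfAdjoint.star_eq] at this
  refine ⟨1 - 2 * Q, ?_, ?_, ?_, ?_⟩
  · rw [star_sub, star_mul, hQs, star_one, two_mul, star_ofNat, mul_two]
  · have : (1 - 2 * Q) * (1 - 2 * Q) = 1 - 4 * Q + 4 * (Q * Q) := by noncomm_ring
    rw [this, hQQ]
    abel
  · exact (Commute.one_right V).sub_right ((Nat.cast_commute 2 V).symm.mul_right hVQ)
  · have : B * (1 - 2 * Q) = B⁺ + B⁻ := by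
      have e : B * (1 - 2 * Q) = B - 2 * (B * Q) := by noncomm_ring
      have hB' : B⁺ - B⁻ = B := CFC.posPart_sub_negPart B hsa
      have hBQ : B * Q = -B⁻ := by
        calc B * Q = (B⁺ - B⁻) * Q := by rw [hB']
          _ = -B⁻ := by rw [sub_mul, h1, h3, zero_sub]
      calc B * (1 - 2 * Q) = (B⁺ - B⁻) - 2 * (B * Q) := by rw [e, hB']
        _ = B⁺ + B⁻ := by rw [hBQ]; noncomm_ring
    rw [this]
    exact add_nonneg (CFC.posPart_nonneg B) (CFC.negPart_nonneg B)

/-- The spectrum of g may be the whole circle, so g and 1 can be at distance 2. The intermediate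
point D = i R is at distance less than 2 from both: D + D* = 0, and g D* + D g* = i(g* - g) R is
nonnegative. -/
instance pathConnectedSpace_unitary : PathConnectedSpace (U H) := by
  have key : ∀ g : U H, Joined (1 : U H) g := by
    intro g
    obtain ⟨R, hRs, hRR, hVR, hR⟩ := exists_symmetry_mul_nonneg g
    have hII : Complex.I * Complex.I = -1 := Complex.I_mul_I
    let D : U H := ⟨Complex.I • R, by
      rw [Unitary.mem_iff, star_smul, hRs, Complex.star_def, Complex.conj_I, smul_mul_smul_comm,
        smul_mul_smul_comm, hRR]
      simp⟩
    have hD : (D : H →L[ℂ] H) = Complex.I • R := rfl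
    have hDs : star (D : H →L[ℂ] H) = -(Complex.I • R) := by
      rw [hD, star_smul, hRs, Complex.star_def, Complex.conj_I, neg_smul]
    have h1 : Joined (1 : U H) D := by
      refine Unitary.joined _ _ (norm_sub_one_lt_two_of_nonneg D ?_)
      rw [hDs, hD, add_neg_cancel]
    have h2 : Joined D g := by
      refine Unitary.joined _ _ ?_
      rw [Unitary.norm_sub_eq]
      refine norm_sub_one_lt_two_of_nonneg _ (hR.trans_eq ?_)
      rw [Submonoid.coe_mul, Unitary.coe_star, star_mul, star_star, hDs, hD]
      have hc : star (g : H →L[ℂ] H) * R = R * star (g : H →L[ℂ] H) := by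
        have := congrArg star hVR.eq
        rwa [star_mul, star_mul, hRs, eq_comm] at this
      rw [smul_mul_assoc, smul_mul_assoc, ← hc, sub_mul, smul_sub, mul_neg, mul_smul_comm]
      abel
    exact h1.trans h2
  exact ⟨⟨1⟩, fun a b => (key a).symm.trans (key b)⟩

end UnitaryConnected

/-! ### Topology of the space of rays and the embedding by projections -/

section ProjectiveTopology

variable {H : Type u} [NormedAddCommGroup H] [InnerProductSpace ℂ H]

/-- The saturation of an open set is the union of its preimages under multiplication by nonzero
scalars. -/
theorem isOpenQuotientMap_mk :
    IsOpenQuotientMap (fun v : {v : H // v ≠ 0} => Projectivization.mk ℂ v.1 v.2) := by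
  refine ⟨isQuotientMap_mk.surjective, isQuotientMap_mk.continuous, fun s hs => ?_⟩
  rw [← isQuotientMap_mk.isOpen_preimage]
  have : (fun v : {v : H // v ≠ 0} => Projectivization.mk ℂ v.1 v.2) ⁻¹'
      ((fun v : {v : H // v ≠ 0} => Projectivization.mk ℂ v.1 v.2) '' s) =
      ⋃ c : ℂˣ, (fun v : {v : H // v ≠ 0} =>
        (⟨(c : ℂ) • v.1, smul_ne_zero c.ne_zero v.2⟩ : {v : H // v ≠ 0})) ⁻¹' s := by
    ext v
    simp only [Set.mem_preimage, Set.mem_image, Set.mem_iUnion, Projectivization.mk_eq_mk_iff]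
    constructor
    · rintro ⟨w, hw, c, hc⟩
      refine ⟨c, ?_⟩
      have : (⟨(c : ℂ) • v.1, smul_ne_zero c.ne_zero v.2⟩ : {v : H // v ≠ 0}) = w := Subtype.ext hc
      rwa [this]
    · rintro ⟨c, hc⟩
      exact ⟨_, hc, c, rfl⟩
  rw [this]
  exact isOpen_iUnion fun c => hs.preimage (by fun_prop)

theorem secondCountableTopology_projectivization [TopologicalSpace.SeparableSpace H] :
    SecondCountableTopology (ℙ ℂ H) := by
  have := UniformSpace.secondCountable_of_separable H
  exact isQuotientMap_mk.secondCountableTopology isOpenQuotientMap_mk.isOpenMap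

theorem exists_norm_eq_one_eq_rayOf (x : ℙ ℂ H) : ∃ φ : H, ∃ hφ : ‖φ‖ = 1, x = rayOf φ hφ := by
  have h0 : ‖x.rep‖ ≠ 0 := norm_ne_zero_iff.2 x.rep_nonzero
  refine ⟨((‖x.rep‖⁻¹ : ℝ) : ℂ) • x.rep, ?_, ?_⟩
  · rw [norm_smul, Complex.norm_real, norm_inv, norm_norm, inv_mul_cancel₀ h0]
  · refine x.mk_rep.symm.trans ((Projectivization.mk_eq_mk_iff' ..).2 ⟨(‖x.rep‖ : ℂ), ?_⟩)
    rw [smul_smul]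
    simp [h0]

theorem inner_rep_rayOf_ne_zero (φ : H) (hφ : ‖φ‖ = 1) : ⟪φ, (rayOf φ hφ).rep⟫_ℂ ≠ 0 := by
  refine (inner_rep_ne_zero_iff φ φ _).2 ?_
  rw [inner_self_eq_norm_sq_to_K, hφ]
  simp

theorem affineCoord_rayOf (φ : H) (hφ : ‖φ‖ = 1) : affineCoord φ (rayOf φ hφ) = 0 := by
  ext1
  have h : ⟪φ, φ⟫_ℂ = 1 := by rw [inner_self_eq_norm_sq_to_K, hφ]; simp
  rw [rayOf, coe_affineCoord_mk φ φ hφ _ (by rw [h]; exact one_ne_zero), h]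
  simp

theorem mk_add_affineCoord (φ : H) (hφ : ‖φ‖ = 1) {x : ℙ ℂ H} (hx : ⟪φ, x.rep⟫_ℂ ≠ 0) :
    Projectivization.mk ℂ (φ + (affineCoord φ x : H)) (add_orthogonal_ne_zero φ hφ _) = x :=
  (affineChart φ hφ).left_inv hx

theorem rayProj_apply (v w : H) :
    rayProj v w = (⟪v, w⟫_ℂ / ((‖v‖ ^ 2 : ℝ) : ℂ)) • v :=
  Submodule.starProjection_singleton ℂ w

theorem rayProj_self (v : H) : rayProj v v = v :=
  Submodule.starProjection_eq_self_iff.2 (Submodule.mem_span_singleton_self v)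

theorem rayProj_apply_of_norm_eq_one {v : H} (hv : ‖v‖ = 1) (w : H) :
    rayProj v w = ⟪v, w⟫_ℂ • v := by
  rw [rayProj_apply, hv]
  simp

theorem rayProj_smul {c : ℂ} (hc : c ≠ 0) (v : H) : rayProj (c • v) = rayProj v := by
  ext w
  rw [rayProj_apply, rayProj_apply, norm_smul, inner_smul_left, smul_smul]
  congr 1
  rcases eq_or_ne v 0 with rfl | hv
  · simp
  have h1 : (‖c‖ : ℂ) ≠ 0 := by simpa using hc
  have h2 : (‖v‖ : ℂ) ≠ 0 := by simpa using hv
  have h3 : starRingEnd ℂ c * c = (‖c‖ : ℂ) ^ 2 := Complex.conj_mul' c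
  push_cast
  field_simp
  linear_combination ⟪v, w⟫_ℂ * h3

theorem rayProj_eq_smul_rankOne (v : H) :
    rayProj v = (‖v‖ ^ 2)⁻¹ • InnerProductSpace.rankOne ℂ v v := by
  ext w
  rw [rayProj_apply, smul_apply, InnerProductSpace.rankOne_apply, ← Complex.coe_smul, smul_smul,
    div_eq_inv_mul, Complex.ofReal_inv]

/-- Bilinear over ℝ only: `rankOne` is conjugate linear in its second argument. -/
theorem isBoundedBilinearMap_rankOne :
    IsBoundedBilinearMap ℝ (fun p : H × H => InnerProductSpace.rankOne ℂ p.1 p.2) where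
  add_left x y z := by simp
  smul_left c x z := by
    rw [← Complex.coe_smul, map_smul]
    rfl
  add_right x y z := by simp
  smul_right c x z := by
    ext w
    rw [smul_apply, InnerProductSpace.rankOne_apply, InnerProductSpace.rankOne_apply,
      ← Complex.coe_smul c z, inner_smul_left, Complex.conj_ofReal, mul_smul, Complex.coe_smul]
  bound := ⟨1, one_pos, fun x y => by simp⟩

theorem contDiffAt_rayProj {n : ℕ∞ω} {v : H} (hv : v ≠ 0) :
    ContDiffAt ℝ n (rayProj : H → H →L[ℂ] H) v := by
  have e : (rayProj : H → H →L[ℂ] H) =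
      fun v => (‖v‖ ^ 2)⁻¹ • InnerProductSpace.rankOne ℂ v v := funext rayProj_eq_smul_rankOne
  rw [e]
  refine ContDiffAt.smul (ContDiffAt.inv (contDiff_norm_sq ℂ).contDiffAt (by simpa using hv)) ?_
  exact isBoundedBilinearMap_rankOne.contDiff.contDiffAt.comp v
    (f := fun v : H => (v, v)) (contDiffAt_id.prodMk contDiffAt_id)

/-- The orthogonal projection onto a ray. -/
noncomputable def projOf (x : ℙ ℂ H) : H →L[ℂ] H := rayProj x.rep

theorem projOf_mk (v : H) (hv : v ≠ 0) : projOf (Projectivization.mk ℂ v hv) = rayProj v := by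
  obtain ⟨a, ha⟩ := Projectivization.exists_smul_eq_mk_rep ℂ v hv
  rw [projOf, ← ha]
  exact rayProj_smul a.ne_zero v

/-- A ray is recovered as the range of its projection. Identities between rays thereby become
identities between operators. -/
theorem projOf_injective : Function.Injective (projOf : ℙ ℂ H → H →L[ℂ] H) := by
  intro x y h
  have h1 : rayProj y.rep x.rep = x.rep := by
    change projOf y x.rep = _
    rw [← h]
    exact rayProj_self _
  rw [rayProj_apply] at h1
  rw [← x.mk_rep, ← y.mk_rep, Projectivization.mk_eq_mk_iff']
  exact ⟨_, h1⟩

theorem continuous_projOf : Continuous (projOf : ℙ ℂ H → H →L[ℂ] H) := by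
  rw [isQuotientMap_mk.continuous_iff]
  refine continuous_iff_continuousAt.2 fun v => ?_
  have : ContinuousAt (fun w : {v : H // v ≠ 0} => rayProj w.1) v :=
    ContinuousAt.comp (g := rayProj) (contDiffAt_rayProj (n := 0) v.2).continuousAt
      continuous_subtype_val.continuousAt
  exact this.congr (Filter.Eventually.of_forall fun w => (projOf_mk w.1 w.2).symm)

instance t2Space_projectivization : T2Space (ℙ ℂ H) :=
  T2Space.of_injective_continuous projOf_injective continuous_projOf

end ProjectiveTopology

/-! ### Smooth maps into and out of P(H) -/

section ProjectiveSmooth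

variable {H : Type u} [NormedAddCommGroup H] [InnerProductSpace ℂ H] [Nontrivial H]

theorem modelChart_mem_atlas (φ : H) (hφ : ‖φ‖ = 1) (L : (ℂ ∙ φ)ᗮ ≃ₗᵢ[ℂ] PModel H) :
    modelChart φ hφ L ∈ atlas (PModel H) (ℙ ℂ H) := ⟨φ, hφ, L, rfl⟩

theorem nonempty_isometry_pModel (φ : H) (hφ : ‖φ‖ = 1) :
    Nonempty ((ℂ ∙ φ)ᗮ ≃ₗᵢ[ℂ] PModel H) :=
  exists_orthogonal_isometry φ (baseVector H) hφ (norm_baseVector H)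

theorem contMDiffAt_affineCoord {φ : H} (hφ : ‖φ‖ = 1) {x : ℙ ℂ H} (hx : ⟪φ, x.rep⟫_ℂ ≠ 0) :
    ContMDiffAt 𝓘(ℝ, PModel H) 𝓘(ℝ, (ℂ ∙ φ)ᗮ) ∞ (affineCoord φ) x := by
  obtain ⟨L⟩ := nonempty_isometry_pModel φ hφ
  have h1 : ContMDiffAt 𝓘(ℝ, PModel H) 𝓘(ℝ, PModel H) ∞ (modelChart φ hφ L) x :=
    contMDiffAt_of_mem_maximalAtlas (IsManifold.subset_maximalAtlas (modelChart_mem_atlas φ hφ L))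
      (by simpa [modelChart, affineChart] using hx)
  have h2 : ContMDiff 𝓘(ℝ, PModel H) 𝓘(ℝ, (ℂ ∙ φ)ᗮ) ∞ L.symm :=
    ((L.symm.contDiff (n := ∞)).restrict_scalars ℝ).contMDiff
  refine (h2.contMDiffAt.comp x h1).congr_of_eventuallyEq (Filter.Eventually.of_forall fun y => ?_)
  exact (L.symm_apply_apply (affineCoord φ y)).symm

theorem contMDiff_affineChart_symm {φ : H} (hφ : ‖φ‖ = 1) :
    ContMDiff 𝓘(ℝ, (ℂ ∙ φ)ᗮ) 𝓘(ℝ, PModel H) ∞ (affineChart φ hφ).symm := by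
  obtain ⟨L⟩ := nonempty_isometry_pModel φ hφ
  have h1 : ContMDiffOn 𝓘(ℝ, PModel H) 𝓘(ℝ, PModel H) ∞ (modelChart φ hφ L).symm Set.univ := by
    have := contMDiffOn_symm_of_mem_maximalAtlas (I := 𝓘(ℝ, PModel H)) (n := ∞)
      (IsManifold.subset_maximalAtlas (modelChart_mem_atlas φ hφ L))
    simpa [modelChart, affineChart] using this
  have h2 : ContMDiff 𝓘(ℝ, (ℂ ∙ φ)ᗮ) 𝓘(ℝ, PModel H) ∞ L :=
    ((L.contDiff (n := ∞)).restrict_scalars ℝ).contMDiff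
  refine ((contMDiffOn_univ.1 h1).comp h2).congr fun u => ?_
  change _ = (affineChart φ hφ).symm (L.symm (L u))
  rw [L.symm_apply_apply]

theorem contMDiffAt_add_affineCoord {φ : H} (hφ : ‖φ‖ = 1) {x : ℙ ℂ H}
    (hx : ⟪φ, x.rep⟫_ℂ ≠ 0) :
    ContMDiffAt 𝓘(ℝ, PModel H) 𝓘(ℝ, H) ∞ (fun y => φ + (affineCoord φ y : H)) x := by
  have : ContDiff ℝ ∞ fun u : (ℂ ∙ φ)ᗮ => φ + (u : H) :=
    contDiff_const.add (((ℂ ∙ φ)ᗮ.subtypeL.contDiff (n := ∞)).restrict_scalars ℝ)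
  exact ContMDiffAt.comp x (g := fun u : (ℂ ∙ φ)ᗮ => φ + (u : H)) this.contMDiff.contMDiffAt
    (contMDiffAt_affineCoord hφ hx)

section

variable {E' : Type*} [NormedAddCommGroup E'] [NormedSpace ℝ E'] {H' : Type*} [TopologicalSpace H']
  {I : ModelWithCorners ℝ E' H'} {M : Type*} [TopologicalSpace M] [ChartedSpace H' M]

/-- A map to the projective space with a smooth nonvanishing lift is smooth. -/
theorem contMDiffAt_of_lift {f : M → ℙ ℂ H} {v : M → H} {m : M}
    (hv : ContMDiffAt I 𝓘(ℝ, H) ∞ v m) (hm : v m ≠ 0)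
    (hf : ∀ᶠ y in 𝓝 m, ∀ h : v y ≠ 0, f y = Projectivization.mk ℂ (v y) h) :
    ContMDiffAt I 𝓘(ℝ, PModel H) ∞ f m := by
  obtain ⟨φ, hφ, hx⟩ := exists_norm_eq_one_eq_rayOf (Projectivization.mk ℂ (v m) hm)
  have h0 : ⟪φ, v m⟫_ℂ ≠ 0 := by
    rw [← inner_rep_ne_zero_iff φ (v m) hm, hx]
    exact inner_rep_rayOf_ne_zero φ hφ
  -- The coordinate b_φ of the ray of w, as a function of w, is smooth on the open set ⟨φ, w⟩ ≠ 0;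
  -- it is composed with the lift v.
  have hc : ContDiffAt ℝ ∞ (fun w : H =>
      (ℂ ∙ φ)ᗮ.orthogonalProjectionOnto ((⟪φ, w⟫_ℂ)⁻¹ • w)) (v m) := by
    refine ContDiffAt.restrict_scalars ℝ (𝕜' := ℂ) ?_
    refine (ContinuousLinearMap.contDiff _).contDiffAt.comp _ ?_
    refine ContDiffAt.smul (ContDiffAt.inv ?_ h0) contDiffAt_id
    exact (innerSL ℂ φ).contDiff.contDiffAt
  have h1 := (contMDiff_affineChart_symm hφ).contMDiffAt.comp m (hc.contMDiffAt.comp m hv)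
  refine h1.congr_of_eventuallyEq ?_
  have hcont : ContinuousAt (fun y => ⟪φ, v y⟫_ℂ) m :=
    ((innerSL ℂ φ).continuous.continuousAt).comp hv.continuousAt
  filter_upwards [hf, hcont.eventually_ne h0] with y hy hy0
  have hvy : v y ≠ 0 := by rintro e; simp [e] at hy0
  rw [hy hvy]
  change _ = (affineChart φ hφ).symm _
  rw [Function.comp_apply, ← affineCoord_mk φ (v y) hvy]
  exact ((affineChart φ hφ).left_inv ((inner_rep_ne_zero_iff φ _ hvy).2 hy0)).symm

end

/-- Near the ray of φ, P_x is the projection onto the nonvanishing smooth vector φ + b_φ(x). -/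
theorem contMDiff_projOf :
    ContMDiff 𝓘(ℝ, PModel H) 𝓘(ℝ, H →L[ℂ] H) ∞ (projOf : ℙ ℂ H → H →L[ℂ] H) := by
  intro x
  obtain ⟨φ, hφ, rfl⟩ := exists_norm_eq_one_eq_rayOf x
  have hx := inner_rep_rayOf_ne_zero φ hφ
  have h1 := ContMDiffAt.comp (rayOf φ hφ) (contDiffAt_rayProj (n := ∞) (add_orthogonal_ne_zero φ hφ
    (affineCoord φ (rayOf φ hφ)))).contMDiffAt (contMDiffAt_add_affineCoord hφ hx)
  refine h1.congr_of_eventuallyEq ?_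
  filter_upwards [(isOpen_inner_rep_ne_zero φ).mem_nhds hx] with y hy
  rw [Function.comp_apply, ← projOf_mk _ (add_orthogonal_ne_zero φ hφ _),
    mk_add_affineCoord φ hφ hy]

end ProjectiveSmooth

/-! ### Reflections, transitivity and the isotropy groups -/

section UnitaryAction

variable {H : Type u} [NormedAddCommGroup H] [InnerProductSpace ℂ H] [CompleteSpace H]

theorem unitary_apply_ne_zero (g : U H) {v : H} (hv : v ≠ 0) : (g : H →L[ℂ] H) v ≠ 0 := by
  rw [← norm_ne_zero_iff, Unitary.norm_map]
  exact norm_ne_zero_iff.2 hv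

theorem unitary_smul_mk (g : U H) (v : H) (hv : v ≠ 0) :
    g • Projectivization.mk ℂ v hv =
      Projectivization.mk ℂ ((g : H →L[ℂ] H) v) (unitary_apply_ne_zero g hv) := rfl

theorem unitary_smul_rayOf (g : U H) (φ : H) (hφ : ‖φ‖ = 1) :
    g • rayOf φ hφ = rayOf ((g : H →L[ℂ] H) φ) ((Unitary.norm_map g φ).trans hφ) := rfl

theorem star_apply_apply (g : U H) (v : H) : star (g : H →L[ℂ] H) ((g : H →L[ℂ] H) v) = v := by
  rw [← mul_apply_eq_comp, Unitary.coe_star_mul_self, one_apply_eq_self]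

theorem rayProj_unitary (g : U H) (v : H) :
    rayProj ((g : H →L[ℂ] H) v) = g * rayProj v * star (g : H →L[ℂ] H) := by
  ext w
  rw [rayProj_apply, mul_apply_eq_comp, mul_apply_eq_comp, rayProj_apply, map_smul,
    Unitary.norm_map, ContinuousLinearMap.star_eq_adjoint, ContinuousLinearMap.adjoint_inner_right]

theorem projOf_smul (g : U H) (x : ℙ ℂ H) :
    projOf (g • x) = g * projOf x * star (g : H →L[ℂ] H) := by
  induction x using Projectivization.ind with | h v hv =>
  rw [unitary_smul_mk, projOf_mk, projOf_mk, rayProj_unitary]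

theorem reflS_apply (w v : H) : (reflS w : H →L[ℂ] H) v = v - (2 : ℂ) • rayProj w v := rfl

theorem reflS_apply_self (w : H) : (reflS w : H →L[ℂ] H) w = -w := by
  rw [reflS_apply, rayProj_self]
  module

theorem reflS_mul_self (w : H) : reflS w * reflS w = 1 := by
  have h := (Unitary.mem_iff.1 (reflS w).2).1
  have hs : star (reflS w : H →L[ℂ] H) = reflS w := by
    have h2 : star (rayProj w) = rayProj w := isSelfAdjoint_starProjection (ℂ ∙ w)
    change star (1 - (2 : ℂ) • rayProj w) = 1 - (2 : ℂ) • rayProj w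
    rw [star_sub, star_one, star_smul, h2]
    simp
  rw [hs] at h
  exact Subtype.ext h

theorem inv_reflS (w : H) : (reflS w)⁻¹ = reflS w := inv_eq_of_mul_eq_one_left (reflS_mul_self w)

/-- Two vectors of the same norm with real scalar product are exchanged, up to sign, by the
reflection along their sum. -/
theorem reflS_add_apply {φ ψ : H} (h : ‖φ‖ = ‖ψ‖) (hr : ⟪φ, ψ⟫_ℂ = ⟪ψ, φ⟫_ℂ) :
    (reflS (φ + ψ) : H →L[ℂ] H) φ = -ψ := by
  have h1 : rayProj (φ + ψ) (φ - ψ) = 0 := by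
    rw [rayProj_apply, inner_add_left, inner_sub_right, inner_sub_right, hr,
      inner_self_eq_norm_sq_to_K, inner_self_eq_norm_sq_to_K, h]
    simp
  have h2 := rayProj_self (φ + ψ)
  have h3 : (2 : ℂ) • rayProj (φ + ψ) φ = φ + ψ := by
    rw [← map_smul, show (2 : ℂ) • φ = (φ + ψ) + (φ - ψ) by module, map_add, h1, h2, add_zero]
  rw [reflS_apply, h3]
  abel

theorem coe_mulAut_conj (w : H) (g : U H) : ((MulAut.conj (reflS w) g : U H) : H →L[ℂ] H) =
    reflS w * g * reflS w := by
  rw [MulAut.conj_apply, inv_reflS]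
  rfl

instance isPretransitive_unitary : MulAction.IsPretransitive (U H) (ℙ ℂ H) where
  exists_smul_eq x y := by
    obtain ⟨φ, hφ, rfl⟩ := exists_norm_eq_one_eq_rayOf x
    obtain ⟨ψ, hψ, rfl⟩ := exists_norm_eq_one_eq_rayOf y
    -- A phase does not change the ray of ψ; this one makes the scalar product with φ real, as
    -- `reflS_add_apply` needs.
    obtain ⟨c, hc, hreal⟩ : ∃ c : ℂ, ‖c‖ = 1 ∧ ⟪φ, c • ψ⟫_ℂ = ⟪c • ψ, φ⟫_ℂ := by
      by_cases h : ⟪φ, ψ⟫_ℂ = 0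
      · refine ⟨1, by simp, ?_⟩
        rw [one_smul, h, ← inner_conj_symm, h, map_zero]
      · refine ⟨(‖⟪φ, ψ⟫_ℂ‖ : ℂ) / ⟪φ, ψ⟫_ℂ, by simp [h], ?_⟩
        rw [← inner_conj_symm (_ • ψ) φ, inner_smul_right, div_mul_cancel₀ _ h,
          Complex.conj_ofReal]
    have hn : ‖φ‖ = ‖c • ψ‖ := by rw [norm_smul, hc, hφ, hψ, one_mul]
    refine ⟨reflS (φ + c • ψ), ?_⟩
    rw [unitary_smul_rayOf, rayOf, rayOf, Projectivization.mk_eq_mk_iff']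
    exact ⟨-c, by rw [reflS_add_apply hn hreal, neg_smul]⟩

theorem mem_stabilizer_iff_commute (φ : H) (hφ : ‖φ‖ = 1) (g : U H) :
    g ∈ MulAction.stabilizer (U H) (rayOf φ hφ) ↔
      rayProj φ * (g : H →L[ℂ] H) = g * rayProj φ := by
  have h0 : projOf (rayOf φ hφ) = rayProj φ := projOf_mk _ _
  rw [MulAction.mem_stabilizer_iff, ← projOf_injective.eq_iff, projOf_smul, h0]
  constructor
  · intro h
    nth_rw 1 [← h]
    rw [mul_assoc, Unitary.coe_star_mul_self, mul_one]
  · intro h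
    rw [← h, mul_assoc, Unitary.mul_star_self_of_mem g.2, mul_one]

theorem mem_stabilizer_iff_exists_smul (φ : H) (hφ : ‖φ‖ = 1) (g : U H) :
    g ∈ MulAction.stabilizer (U H) (rayOf φ hφ) ↔ ∃ c : ℂ, (g : H →L[ℂ] H) φ = c • φ := by
  rw [MulAction.mem_stabilizer_iff, unitary_smul_rayOf, rayOf, rayOf,
    Projectivization.mk_eq_mk_iff']
  exact exists_congr fun c => eq_comm

theorem mem_stabilizer_iff_map (φ : H) (hφ : ‖φ‖ = 1) (g : U H) :
    g ∈ MulAction.stabilizer (U H) (rayOf φ hφ) ↔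
      (ℂ ∙ φ).map ((g : H →L[ℂ] H) : H →ₗ[ℂ] H) = ℂ ∙ φ := by
  rw [mem_stabilizer_iff_exists_smul, Submodule.map_span, Set.image_singleton]
  have hφ0 : φ ≠ 0 := by rintro rfl; simp at hφ
  constructor
  · rintro ⟨c, hc⟩
    have hc0 : c ≠ 0 := by
      rintro rfl
      exact unitary_apply_ne_zero g hφ0 (by rw [hc, zero_smul])
    rw [ContinuousLinearMap.coe_coe, hc, Submodule.span_singleton_smul_eq (IsUnit.mk0 c hc0)]
  · intro h
    have : (g : H →L[ℂ] H) φ ∈ ℂ ∙ φ := h ▸ Submodule.mem_span_singleton_self _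
    obtain ⟨c, hc⟩ := Submodule.mem_span_singleton.1 this
    exact ⟨c, hc.symm⟩

theorem commute_rayProj_iff_commute_reflS (φ : H) (T : H →L[ℂ] H) :
    rayProj φ * T = T * rayProj φ ↔ (reflS φ : H →L[ℂ] H) * T = T * reflS φ := by
  change _ ↔ (1 - (2 : ℂ) • rayProj φ) * T = T * (1 - (2 : ℂ) • rayProj φ)
  rw [sub_mul, mul_sub, one_mul, mul_one, smul_mul_assoc, mul_smul_comm, sub_right_inj,
    (smul_right_injective _ (two_ne_zero : (2 : ℂ) ≠ 0)).eq_iff]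

/-- S and P_χ are affine functions of each other, so they have the same commutant. -/
theorem mem_stabilizer_iff_conj (φ : H) (hφ : ‖φ‖ = 1) (g : U H) :
    g ∈ MulAction.stabilizer (U H) (rayOf φ hφ) ↔ MulAut.conj (reflS φ) g = g := by
  rw [mem_stabilizer_iff_commute, commute_rayProj_iff_commute_reflS, MulAut.conj_apply,
    mul_inv_eq_iff_eq_mul, ← Subtype.val_inj, Submonoid.coe_mul, Submonoid.coe_mul]

theorem reflS_mem_stabilizer (φ : H) (hφ : ‖φ‖ = 1) :
    reflS φ ∈ MulAction.stabilizer (U H) (rayOf φ hφ) :=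
  (mem_stabilizer_iff_exists_smul φ hφ _).2 ⟨-1, by rw [reflS_apply_self, neg_one_smul]⟩

/-- The only ray not orthogonal to `φ` and fixed by the reflection along `φ` is the ray of `φ`. -/
theorem eq_rayOf_of_reflS_smul_eq (φ : H) (hφ : ‖φ‖ = 1) {x : ℙ ℂ H} (hx : ⟪φ, x.rep⟫_ℂ ≠ 0)
    (h : reflS φ • x = x) : x = rayOf φ hφ := by
  induction x using Projectivization.ind with | h v hv =>
  rw [inner_rep_ne_zero_iff φ v hv] at hx
  rw [unitary_smul_mk, Projectivization.mk_eq_mk_iff'] at h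
  obtain ⟨c, hc⟩ := h
  rw [reflS_apply, rayProj_apply_of_norm_eq_one hφ] at hc
  have h1 := congrArg (fun w => ⟪φ, w⟫_ℂ) hc
  simp only [inner_smul_right, inner_sub_right, inner_self_eq_norm_sq_to_K, hφ] at h1
  -- The reflection changes the sign of the φ-component, which is nonzero, so the eigenvalue is -1;
  -- then v = ⟨φ, v⟩ φ.
  have h2 : c = -1 := by
    have : (c + 1) * ⟪φ, v⟫_ℂ = 0 := by
      rw [add_mul, h1]
      push_cast
      ring
    rcases mul_eq_zero.1 this with h | h
    · exact eq_neg_of_add_eq_zero_left h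
    · exact absurd h hx
  rw [rayOf, Projectivization.mk_eq_mk_iff']
  refine ⟨⟪φ, v⟫_ℂ, ?_⟩
  rw [h2] at hc
  have h3 : (2 : ℂ) • (⟪φ, v⟫_ℂ • φ) = (2 : ℂ) • v := by
    rw [eq_sub_iff_add_eq] at hc
    calc (2 : ℂ) • (⟪φ, v⟫_ℂ • φ) = ((-1 : ℂ) • v + (2 : ℂ) • ⟪φ, v⟫_ℂ • φ) + v := by module
      _ = (2 : ℂ) • v := by rw [hc, two_smul]
  exact smul_right_injective H (two_ne_zero : (2 : ℂ) ≠ 0) h3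

end UnitaryAction

/-! ### Smoothness, holomorphy and local sections of the action -/

section SmoothAction

variable {H : Type u} [NormedAddCommGroup H] [InnerProductSpace ℂ H] [CompleteSpace H]
  [Nontrivial H]

/-- The lift used is (g, x) ↦ g(φ + b_φ(x)), a bounded bilinear evaluation of smooth maps. -/
theorem contMDiff_unitary_smul :
    ContMDiff (𝓘(ℝ, LieU H).prod 𝓘(ℝ, PModel H)) 𝓘(ℝ, PModel H) ∞
      (fun p : U H × ℙ ℂ H => p.1 • p.2) := by
  rintro ⟨g, x⟩
  obtain ⟨φ, hφ, rfl⟩ := exists_norm_eq_one_eq_rayOf x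
  have hx := inner_rep_rayOf_ne_zero φ hφ
  have h1 : ContMDiffAt (𝓘(ℝ, LieU H).prod 𝓘(ℝ, PModel H)) 𝓘(ℝ, H →L[ℂ] H) ∞
      (fun p : U H × ℙ ℂ H => (p.1 : H →L[ℂ] H)) (g, rayOf φ hφ) :=
    ContMDiffAt.comp (g := fun k : U H => (k : H →L[ℂ] H)) (g, rayOf φ hφ)
      contMDiff_coe_unitary.contMDiffAt contMDiffAt_fst
  have h2 : ContMDiffAt (𝓘(ℝ, LieU H).prod 𝓘(ℝ, PModel H)) 𝓘(ℝ, H) ∞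
      (fun p : U H × ℙ ℂ H => φ + (affineCoord φ p.2 : H)) (g, rayOf φ hφ) :=
    ContMDiffAt.comp (g := fun y : ℙ ℂ H => φ + (affineCoord φ y : H)) (g, rayOf φ hφ)
      (contMDiffAt_add_affineCoord hφ hx) contMDiffAt_snd
  have hb : ContDiff ℝ ∞ (fun q : (H →L[ℂ] H) × H => q.1 q.2) :=
    (isBoundedBilinearMap_apply (𝕜 := ℂ) (E := H) (F := H)).contDiff.restrict_scalars ℝ
  have h3 := hb.contMDiff.contMDiffAt.comp (g, rayOf φ hφ) (h1.prodMk_space h2)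
  refine contMDiffAt_of_lift h3 (unitary_apply_ne_zero g (add_orthogonal_ne_zero φ hφ _)) ?_
  have hs : ∀ᶠ p : U H × ℙ ℂ H in 𝓝 (g, rayOf φ hφ), ⟪φ, p.2.rep⟫_ℂ ≠ 0 :=
    ((isOpen_inner_rep_ne_zero φ).preimage continuous_snd).mem_nhds hx
  filter_upwards [hs] with p hp h
  conv_lhs => rw [← mk_add_affineCoord φ hφ hp]
  rfl

instance continuousSMul_unitary : ContinuousSMul (U H) (ℙ ℂ H) :=
  ⟨contMDiff_unitary_smul.continuous⟩

theorem contMDiff_unitary_smul_left (g : U H) :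
    ContMDiff 𝓘(ℝ, PModel H) 𝓘(ℝ, PModel H) ∞ (fun x : ℙ ℂ H => g • x) :=
  contMDiff_unitary_smul.comp (contMDiff_const.prodMk contMDiff_id)

theorem contMDiff_orbit (x : ℙ ℂ H) :
    ContMDiff 𝓘(ℝ, LieU H) 𝓘(ℝ, PModel H) ∞ (fun g : U H => g • x) :=
  contMDiff_unitary_smul.comp (contMDiff_id.prodMk contMDiff_const)

/-- Unitary operators map affine charts to affine charts. -/
theorem exists_modelChart_symm_smul (g : U H) (φ : H) (hφ : ‖φ‖ = 1)
    (L : (ℂ ∙ φ)ᗮ ≃ₗᵢ[ℂ] PModel H) : ∃ c ∈ atlas (PModel H) (ℙ ℂ H), c.target = Set.univ ∧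
      ∀ u, g • (modelChart φ hφ L).symm u = c.symm u := by
  set G : H ≃ₗᵢ[ℂ] H := Unitary.linearIsometryEquiv g with hG
  have hGg : ∀ v, G v = (g : H →L[ℂ] H) v := fun v => rfl
  have hmap : (ℂ ∙ φ)ᗮ.map (G.toLinearEquiv : H →ₗ[ℂ] H) = (ℂ ∙ ((g : H →L[ℂ] H) φ))ᗮ := by
    rw [Submodule.map_orthogonal_equiv, Submodule.map_span, Set.image_singleton]
    rfl
  let K : (ℂ ∙ φ)ᗮ ≃ₗᵢ[ℂ] (ℂ ∙ ((g : H →L[ℂ] H) φ))ᗮ :=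
    (LinearIsometryEquiv.submoduleMap _ G).trans (LinearIsometryEquiv.ofEq _ _ hmap)
  have hK : ∀ u, (K u : H) = (g : H →L[ℂ] H) u := fun u => rfl
  refine ⟨_, modelChart_mem_atlas ((g : H →L[ℂ] H) φ) ((Unitary.norm_map g φ).trans hφ)
    (K.symm.trans L), by simp [modelChart, affineChart], fun u => ?_⟩
  change Projectivization.mk ℂ ((g : H →L[ℂ] H) (φ + (L.symm u : H))) _ =
    Projectivization.mk ℂ ((g : H →L[ℂ] H) φ + (K (L.symm u) : H)) _
  congr 1
  rw [hK, map_add]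

/-- Since g carries b_φ to b_{gφ}, it is the identity in suitable charts of the atlas at x and at g
x. -/
theorem contMDiff_holomorphic_smul (g : U H) :
    ContMDiff 𝓘(ℂ, PModel H) 𝓘(ℂ, PModel H) ω (fun x : ℙ ℂ H => g • x) := by
  intro x
  obtain ⟨φ, hφ, L, hx⟩ := exists_modelChart x
  obtain ⟨c, hc, hcu, h⟩ := exists_modelChart_symm_smul g φ hφ L
  have h1 : ContMDiffAt 𝓘(ℂ, PModel H) 𝓘(ℂ, PModel H) ω (modelChart φ hφ L) x :=
    contMDiffAt_of_mem_maximalAtlas (IsManifold.subset_maximalAtlas (modelChart_mem_atlas φ hφ L)) hx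
  have h2 : ContMDiffOn 𝓘(ℂ, PModel H) 𝓘(ℂ, PModel H) ω c.symm Set.univ :=
    hcu ▸ contMDiffOn_symm_of_mem_maximalAtlas (IsManifold.subset_maximalAtlas hc)
  refine ((contMDiffOn_univ.1 h2).contMDiffAt.comp x h1).congr_of_eventuallyEq ?_
  filter_upwards [(modelChart φ hφ L).open_source.mem_nhds hx] with y hy
  rw [Function.comp_apply, ← h, (modelChart φ hφ L).left_inv hy]

instance connectedSpace_projectivization : ConnectedSpace (ℙ ℂ H) := by
  have hs : Function.Surjective fun g : U H => g • rayOf (baseVector H) (norm_baseVector H) :=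
    MulAction.surjective_smul (U H) _
  exact hs.connectedSpace (contMDiff_orbit _).continuous

/-- A continuous local section of the orbit map. -/
theorem exists_local_section (φ : H) (hφ : ‖φ‖ = 1) : ∃ τ : ℙ ℂ H → U H,
    ContinuousAt τ (rayOf φ hφ) ∧ τ (rayOf φ hφ) = 1 ∧
      ∀ᶠ x in 𝓝 (rayOf φ hφ), τ x • rayOf φ hφ = x := by
  have hx := inner_rep_rayOf_ne_zero φ hφ
  have hφ0 : φ ≠ 0 := by rintro rfl; simp at hφ
  let s : ℙ ℂ H → H := fun x => φ + (affineCoord φ x : H)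
  have hs0 : ∀ x, s x ≠ 0 := fun x => add_orthogonal_ne_zero φ hφ _
  have hs : s (rayOf φ hφ) = φ := by simp [s, affineCoord_rayOf φ hφ]
  let ψ : ℙ ℂ H → H := fun x => (‖s x‖⁻¹ : ℝ) • s x
  have hψ : ψ (rayOf φ hφ) = φ := by simp [ψ, hs, hφ]
  have hψ1 : ∀ x, ‖ψ x‖ = 1 := fun x => by
    rw [norm_smul, norm_inv, norm_norm, inv_mul_cancel₀ (norm_ne_zero_iff.2 (hs0 x))]
  have hsc : ContinuousAt s (rayOf φ hφ) := (contMDiffAt_add_affineCoord hφ hx).continuousAt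
  have hψc : ContinuousAt ψ (rayOf φ hφ) :=
    (hsc.norm.inv₀ (norm_ne_zero_iff.2 (hs0 _))).smul hsc
  -- The first reflection sends φ to -φ, the second sends φ to -ψ(x), so the product sends φ to
  -- ψ(x). At x = φ̂ both reflections coincide, which gives 1. The scalar product ⟨φ, ψ(x)⟩ =
  -- 1/‖s(x)‖ is real by construction.
  refine ⟨fun x => reflS (φ + ψ x) * reflS φ, ?_, ?_, ?_⟩
  · refine ContinuousAt.mul (Topology.IsInducing.subtypeVal.continuousAt_iff.2 ?_) continuousAt_const
    have hne : φ + ψ (rayOf φ hφ) ≠ 0 := by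
      rw [hψ, ← two_smul ℂ]
      exact smul_ne_zero two_ne_zero hφ0
    have h1 : ContinuousAt (fun x => rayProj (φ + ψ x)) (rayOf φ hφ) :=
      ContinuousAt.comp (g := rayProj) (contDiffAt_rayProj (n := 0) hne).continuousAt
        (continuousAt_const.add hψc)
    exact continuousAt_const.sub (h1.const_smul (2 : ℂ))
  · have : reflS (φ + ψ (rayOf φ hφ)) = reflS φ := by
      refine Subtype.ext ?_
      change 1 - (2 : ℂ) • rayProj _ = 1 - (2 : ℂ) • rayProj _
      rw [hψ, ← two_smul ℂ φ, rayProj_smul two_ne_zero]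
    beta_reduce
    rw [this, reflS_mul_self]
  · filter_upwards [(isOpen_inner_rep_ne_zero φ).mem_nhds hx] with x hx'
    have hr : ⟪φ, ψ x⟫_ℂ = ⟪ψ x, φ⟫_ℂ := by
      have : ⟪φ, ψ x⟫_ℂ = ((‖s x‖⁻¹ : ℝ) : ℂ) := by
        rw [show ψ x = ((‖s x‖⁻¹ : ℝ) : ℂ) • s x from (Complex.coe_smul _ _).symm,
          inner_smul_right, inner_add_orthogonal φ hφ, mul_one]
      rw [← inner_conj_symm (ψ x), this, Complex.conj_ofReal]
    have hτ : ((reflS (φ + ψ x) * reflS φ : U H) : H →L[ℂ] H) φ = ψ x := by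
      rw [Submonoid.coe_mul, mul_apply_eq_comp, reflS_apply_self, map_neg,
        reflS_add_apply (by rw [hφ, hψ1]) hr, neg_neg]
    rw [← mk_add_affineCoord φ hφ hx', unitary_smul_rayOf, rayOf, Projectivization.mk_eq_mk_iff']
    refine ⟨((‖s x‖⁻¹ : ℝ) : ℂ), ?_⟩
    rw [mk_add_affineCoord φ hφ hx', hτ]
    exact Complex.coe_smul _ _

theorem isOpenQuotientMap_orbit (φ : H) (hφ : ‖φ‖ = 1) :
    IsOpenQuotientMap (fun g : U H => g • rayOf φ hφ) := by
  refine ⟨MulAction.surjective_smul (U H) _, (contMDiff_orbit _).continuous, ?_⟩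
  refine IsOpenMap.of_nhds_le fun g => ?_
  obtain ⟨τ, hτc, hτ1, hτ⟩ := exists_local_section φ hφ
  have hc : ContinuousAt (fun x : ℙ ℂ H => g⁻¹ • x) (g • rayOf φ hφ) :=
    (continuous_const_smul g⁻¹).continuousAt
  have e : g⁻¹ • g • rayOf φ hφ = rayOf φ hφ := inv_smul_smul _ _
  -- Translating the section by g gives a local section through g; such sections at every g force
  -- the orbit map to be open.
  have h1 : Filter.Tendsto (fun x => g * τ (g⁻¹ • x)) (𝓝 (g • rayOf φ hφ)) (𝓝 g) := by
    have hcc : ContinuousAt (fun x => g * τ (g⁻¹ • x)) (g • rayOf φ hφ) :=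
      continuousAt_const.mul (ContinuousAt.comp (g := τ) (by rwa [e]) hc)
    have := hcc.tendsto
    rwa [e, hτ1, mul_one] at this
  have h2 : ∀ᶠ x in 𝓝 (g • rayOf φ hφ), (g * τ (g⁻¹ • x)) • rayOf φ hφ = x := by
    have : ∀ᶠ x in 𝓝 (g • rayOf φ hφ), τ (g⁻¹ • x) • rayOf φ hφ = g⁻¹ • x :=
      hc.tendsto.eventually (p := fun y => τ y • rayOf φ hφ = y) (by rwa [e])
    filter_upwards [this] with x hx
    rw [mul_smul, hx, smul_inv_smul]
  exact Filter.le_map_of_right_inverse h2 h1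

end SmoothAction

/-! ### The decomposition of 𝔲(H) and the Lie algebra of the isotropy group -/

section LieAlgebra

variable {H : Type u} [NormedAddCommGroup H] [InnerProductSpace ℂ H] [CompleteSpace H]

theorem star_reflS (φ : H) : star (reflS φ : H →L[ℂ] H) = reflS φ :=
  congrArg Subtype.val (inv_reflS φ)

theorem coe_reflS_mul_self (φ : H) : (reflS φ : H →L[ℂ] H) * reflS φ = 1 :=
  congrArg Subtype.val (reflS_mul_self φ)

theorem coe_AdL (g : U H) (a : LieU H) :
    (AdL g a : H →L[ℂ] H) = g * a * star (g : H →L[ℂ] H) := rfl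

theorem AdL_AdL_reflS (φ : H) (a : LieU H) : AdL (reflS φ) (AdL (reflS φ) a) = a := by
  ext1
  rw [coe_AdL, coe_AdL, star_reflS]
  calc (reflS φ : H →L[ℂ] H) * (reflS φ * a * reflS φ) * reflS φ
      = (reflS φ * reflS φ) * a * (reflS φ * reflS φ) := by noncomm_ring
    _ = a := by rw [coe_reflS_mul_self, one_mul, mul_one]

theorem mul_eq_iff_reflS_conj (φ : H) (A B : H →L[ℂ] H) :
    (reflS φ : H →L[ℂ] H) * A = B * reflS φ ↔ (reflS φ : H →L[ℂ] H) * A * reflS φ = B := by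
  constructor
  · intro h
    rw [h, mul_assoc, coe_reflS_mul_self, mul_one]
  · intro h
    rw [← h, mul_assoc, coe_reflS_mul_self, mul_one]

theorem mem_commutant_iff (φ : H) (a : LieU H) :
    a ∈ commutant φ ↔ AdL (reflS φ) a = a := by
  rw [← Subtype.val_inj, coe_AdL, star_reflS, ← mul_eq_iff_reflS_conj,
    ← commute_rayProj_iff_commute_reflS]
  rfl

theorem mem_anticommutant_iff (φ : H) (a : LieU H) :
    a ∈ anticommutant φ ↔ AdL (reflS φ) a = -a := by
  rw [← Subtype.val_inj, coe_AdL, star_reflS, Submodule.coe_neg, ← mul_eq_iff_reflS_conj, neg_mul]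
  rfl

/-- 𝔥 and 𝔪 are the eigenspaces for 1 and -1 of the involution Ad S. -/
theorem isCompl_commutant_anticommutant (φ : H) : IsCompl (commutant φ) (anticommutant φ) := by
  rw [isCompl_iff, Submodule.disjoint_def, Submodule.codisjoint_iff_exists_add_eq]
  constructor
  · intro a h1 h2
    rw [mem_commutant_iff] at h1
    rw [mem_anticommutant_iff, h1, eq_neg_iff_add_eq_zero, ← two_smul ℝ a] at h2
    exact (smul_eq_zero.1 h2).resolve_left two_ne_zero
  · intro a
    refine ⟨(2⁻¹ : ℝ) • (a + AdL (reflS φ) a), (2⁻¹ : ℝ) • (a - AdL (reflS φ) a), ?_, ?_, ?_⟩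
    · rw [mem_commutant_iff, map_smul, map_add, AdL_AdL_reflS, add_comm]
    · rw [mem_anticommutant_iff, map_smul, map_sub, AdL_AdL_reflS, ← smul_neg, neg_sub]
    · module

theorem closedComplemented_commutant (φ : H) : (commutant φ).ClosedComplemented := by
  let p : LieU H →L[ℝ] LieU H := (2⁻¹ : ℝ) • (ContinuousLinearMap.id ℝ _ + AdL (reflS φ))
  have hp : ∀ a, p a = (2⁻¹ : ℝ) • (a + AdL (reflS φ) a) := fun a => rfl
  refine ⟨p.codRestrict _ fun a => ?_, fun a => ?_⟩
  · rw [mem_commutant_iff, hp, map_smul, map_add, AdL_AdL_reflS, add_comm]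
  · ext1
    change p a = a
    rw [hp, (mem_commutant_iff φ a).1 a.2, ← two_smul ℝ, smul_smul]
    norm_num

theorem AdL_mem_anticommutant (φ : H) (hφ : ‖φ‖ = 1) {g : U H}
    (hg : g ∈ MulAction.stabilizer (U H) (rayOf φ hφ)) {a : LieU H} (ha : a ∈ anticommutant φ) :
    AdL g a ∈ anticommutant φ := by
  rw [mem_stabilizer_iff_commute, commute_rayProj_iff_commute_reflS] at hg
  have hg' : (reflS φ : H →L[ℂ] H) * star (g : H →L[ℂ] H) = star (g : H →L[ℂ] H) * reflS φ := by
    have := congrArg star hg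
    rwa [star_mul, star_mul, star_reflS, eq_comm] at this
  change (reflS φ : H →L[ℂ] H) * a = -(a * reflS φ) at ha
  change (reflS φ : H →L[ℂ] H) * (g * a * star (g : H →L[ℂ] H)) =
    -(g * a * star (g : H →L[ℂ] H) * reflS φ)
  rw [← mul_assoc, ← mul_assoc, hg, mul_assoc (g : H →L[ℂ] H), ha, mul_neg, neg_mul, mul_assoc,
    mul_assoc, hg', mul_assoc, mul_assoc]

/-- Passes commutation through a quotient X = Z Y⁻¹; used in both directions of the Cayley
transform. -/
theorem commute_of_mul_eq {R : Type*} [Ring R] {P X Y Z : R} (h : X * Y = Z) (hY : IsUnit Y)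
    (hPY : P * Y = Y * P) (hPZ : P * Z = Z * P) : P * X = X * P := by
  rw [← hY.mul_left_inj, mul_assoc, h, hPZ, mul_assoc, hPY, ← mul_assoc, h]

theorem cayley_mem_commutant_iff (φ : H) {g : U H} (hg : IsUnit ((g : H →L[ℂ] H) + 1)) :
    cayley g ∈ commutant φ ↔ rayProj φ * (g : H →L[ℂ] H) = g * rayProj φ := by
  change rayProj φ * (cayley g : H →L[ℂ] H) = cayley g * rayProj φ ↔ _
  constructor
  · intro h
    have h1 : cayleyInv (cayley g) = g := cayleyChart.left_inv hg
    have h2 := cayleyInv_mul (cayley g)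
    rw [h1] at h2
    have h3 : rayProj φ * ((2⁻¹ : ℝ) • (cayley g : H →L[ℂ] H)) =
        ((2⁻¹ : ℝ) • (cayley g : H →L[ℂ] H)) * rayProj φ := by
      rw [mul_smul_comm, smul_mul_assoc, h]
    refine commute_of_mul_eq h2 (isUnit_one_sub_half _) ?_ ?_
    · rw [mul_sub, sub_mul, h3, mul_one, one_mul]
    · rw [mul_add, add_mul, h3, mul_one, one_mul]
  · intro h
    have h1 : rayProj φ * ((2⁻¹ : ℝ) • (cayley g : H →L[ℂ] H)) =
        ((2⁻¹ : ℝ) • (cayley g : H →L[ℂ] H)) * rayProj φ := by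
      refine commute_of_mul_eq (cayley_mul hg) hg ?_ ?_
      · rw [mul_add, add_mul, h, mul_one, one_mul]
      · rw [mul_sub, sub_mul, h, mul_one, one_mul]
    rw [mul_smul_comm, smul_mul_assoc] at h1
    exact smul_right_injective _ (by norm_num : (2⁻¹ : ℝ) ≠ 0) h1

/-- The chart at k is the Cayley transform of k⁻¹ g, and for k in the isotropy group it carries that
group to 𝔥, which is complemented by means of (1 + Ad S)/2. -/
theorem isLieSubgroup_stabilizer (x : ℙ ℂ H) :
    IsLieSubgroup (LieU H) (MulAction.stabilizer (U H) x) := by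
  obtain ⟨φ, hφ, rfl⟩ := exists_norm_eq_one_eq_rayOf x
  intro k hk
  refine ⟨chartAt (LieU H) k, IsManifold.chart_mem_maximalAtlas k, mem_chart_source _ k,
    commutant φ, closedComplemented_commutant φ, fun g hg => ?_⟩
  have hg' : IsUnit (((k⁻¹ * g : U H) : H →L[ℂ] H) + 1) := hg.2
  rw [chartAt_unitary_apply, cayley_mem_commutant_iff φ hg', ← mem_stabilizer_iff_commute φ hφ,
    Subgroup.mul_mem_cancel_left _ (inv_mem hk)]

/-- Conversely, differentiating P exp(ta) = exp(ta) P at t = 0 gives commutation with a. -/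
theorem mem_commutant_iff_exp (φ : H) (hφ : ‖φ‖ = 1) (a : LieU H) : a ∈ commutant φ ↔
    ∀ t : ℝ, ∃ g ∈ MulAction.stabilizer (U H) (rayOf φ hφ),
      (g : H →L[ℂ] H) = NormedSpace.exp (t • (a : H →L[ℂ] H)) := by
  change rayProj φ * (a : H →L[ℂ] H) = a * rayProj φ ↔ _
  constructor
  · intro h t
    let _ : NormedAlgebra ℚ (H →L[ℂ] H) := NormedAlgebra.restrictScalars ℚ ℂ (H →L[ℂ] H)
    have ht : Commute (rayProj φ) (t • (a : H →L[ℂ] H)) := by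
      change _ * _ = _ * _
      rw [mul_smul_comm, smul_mul_assoc, h]
    refine ⟨⟨_, NormedSpace.exp_mem_unitary_of_mem_skewAdjoint (t • a).2⟩, ?_, rfl⟩
    exact (mem_stabilizer_iff_commute φ hφ _).2 ht.exp_right
  · intro h
    have h0 := hasDerivAt_exp_smul_const (𝕂 := ℝ) (a : H →L[ℂ] H) (0 : ℝ)
    rw [zero_smul, NormedSpace.exp_zero, one_mul] at h0
    refine (h0.const_mul (rayProj φ)).unique ((h0.mul_const (rayProj φ)).congr_of_eventuallyEq
      (Filter.Eventually.of_forall fun t => ?_))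
    obtain ⟨g, hg, e⟩ := h t
    beta_reduce
    rw [← e]
    exact (mem_stabilizer_iff_commute φ hφ g).1 hg

theorem contMDiff_conj_reflS (φ : H) :
    ContMDiff 𝓘(ℝ, LieU H) 𝓘(ℝ, LieU H) ∞ (MulAut.conj (reflS φ) : U H → U H) := by
  have : ContMDiff 𝓘(ℝ, LieU H) 𝓘(ℝ, LieU H) ∞ (fun g : U H => reflS φ * g * (reflS φ)⁻¹) :=
    (contMDiff_const.mul contMDiff_id).mul contMDiff_const
  exact this

/-- Composed with the inclusion into the operators, the automorphism is the restriction of the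
linear map T ↦ S T S; the differential of the inclusion is injective, which determines D. -/
theorem hasMFDerivAt_conj_reflS (φ : H) :
    HasMFDerivAt 𝓘(ℝ, LieU H) 𝓘(ℝ, LieU H) (MulAut.conj (reflS φ)) (1 : U H)
      (AdL (reflS φ)) := by
  have h := ((contMDiff_conj_reflS φ).mdifferentiableAt (x := 1) (by simp)).hasMFDerivAt
  have h1 : HasMFDerivAt 𝓘(ℝ, LieU H) 𝓘(ℝ, H →L[ℂ] H) (fun g : U H => (g : H →L[ℂ] H))
      (MulAut.conj (reflS φ) (1 : U H)) (skewAdjoint.submodule ℝ (H →L[ℂ] H)).subtypeL := by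
    have : ∀ g : U H, g = 1 → HasMFDerivAt 𝓘(ℝ, LieU H) 𝓘(ℝ, H →L[ℂ] H)
        (fun g : U H => (g : H →L[ℂ] H)) g (skewAdjoint.submodule ℝ (H →L[ℂ] H)).subtypeL := by
      rintro _ rfl
      exact hasMFDerivAt_coe_unitary_one
    exact this _ (map_one _)
  let C : (H →L[ℂ] H) →L[ℝ] (H →L[ℂ] H) :=
    (ContinuousLinearMap.mul ℝ (H →L[ℂ] H) (reflS φ)).comp
      ((ContinuousLinearMap.mul ℝ (H →L[ℂ] H)).flip (reflS φ))
  have h2 : HasMFDerivAt 𝓘(ℝ, H →L[ℂ] H) 𝓘(ℝ, H →L[ℂ] H) C ((1 : U H) : H →L[ℂ] H) C :=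
    C.hasFDerivAt.hasMFDerivAt
  have h3 := (h2.comp (1 : U H) hasMFDerivAt_coe_unitary_one).congr_of_eventuallyEq
    (f₁ := (fun g : U H => (g : H →L[ℂ] H)) ∘ MulAut.conj (reflS φ))
    (Filter.Eventually.of_forall fun g => by
      simp only [Function.comp_apply, coe_mulAut_conj]
      simp [C, mul_assoc])
  let D : LieU H →L[ℝ] LieU H :=
    mfderiv 𝓘(ℝ, LieU H) 𝓘(ℝ, LieU H) (MulAut.conj (reflS φ)) (1 : U H)
  have h4 : (skewAdjoint.submodule ℝ (H →L[ℂ] H)).subtypeL.comp D =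
      C.comp (skewAdjoint.submodule ℝ (H →L[ℂ] H)).subtypeL :=
    hasMFDerivAt_unique (h1.comp (1 : U H) h) h3
  have h5 : D = AdL (reflS φ) := by
    ext1 a
    refine Subtype.ext ((DFunLike.congr_fun h4 a).trans ?_)
    rw [coe_AdL, star_reflS]
    simp [C, mul_assoc]
  exact h5 ▸ h

theorem inner_lieU_left (a : LieU H) (v w : H) :
    ⟪(a : H →L[ℂ] H) v, w⟫_ℂ = -⟪v, (a : H →L[ℂ] H) w⟫_ℂ := by
  have := congrArg (fun T : H →L[ℂ] H => ⟪v, T w⟫_ℂ) (star_skew a)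
  simp only [neg_apply, inner_neg_right] at this
  rw [← this, ContinuousLinearMap.star_eq_adjoint, ContinuousLinearMap.adjoint_inner_right]

/-- For a skew-adjoint operator an eigenvector suffices: c is imaginary and ⟨φ, a w⟩ = c ⟨φ, w⟩, so
the orthogonal complement is invariant as well. -/
theorem mem_commutant_iff_exists_smul (φ : H) (hφ : ‖φ‖ = 1) (a : LieU H) :
    a ∈ commutant φ ↔ ∃ c : ℂ, (a : H →L[ℂ] H) φ = c • φ := by
  change rayProj φ * (a : H →L[ℂ] H) = a * rayProj φ ↔ _
  constructor
  · intro h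
    have := congrArg (fun T : H →L[ℂ] H => T φ) h
    rw [mul_apply_eq_comp, mul_apply_eq_comp, rayProj_self,
      rayProj_apply_of_norm_eq_one hφ] at this
    exact ⟨_, this.symm⟩
  · rintro ⟨c, hc⟩
    have h1 : ⟪φ, φ⟫_ℂ = 1 := by rw [inner_self_eq_norm_sq_to_K, hφ]; simp
    have h2 := inner_lieU_left a φ φ
    rw [hc, inner_smul_left, inner_smul_right, h1, mul_one, mul_one] at h2
    ext w
    have h3 := inner_lieU_left a φ w
    rw [hc, inner_smul_left, h2, neg_mul, neg_inj] at h3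
    rw [mul_apply_eq_comp, mul_apply_eq_comp, rayProj_apply_of_norm_eq_one hφ,
      rayProj_apply_of_norm_eq_one hφ, map_smul, hc, ← h3, smul_smul, mul_comm]

theorem inner_apply_of_mem_anticommutant {φ : H} (hφ : ‖φ‖ = 1) {a : LieU H}
    (ha : a ∈ anticommutant φ) : ⟪φ, (a : H →L[ℂ] H) φ⟫_ℂ = 0 := by
  have h0 : φ ≠ 0 := by rintro rfl; simp at hφ
  have h : (reflS φ : H →L[ℂ] H) ((a : H →L[ℂ] H) φ) = -((a : H →L[ℂ] H) (reflS φ • φ)) :=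
    congrArg (fun T : H →L[ℂ] H => T φ) ha
  rw [show reflS φ • φ = -φ from reflS_apply_self φ, map_neg, neg_neg, reflS_apply,
    sub_eq_self, rayProj_apply_of_norm_eq_one hφ] at h
  simpa [h0] using h

/-- In the splitting ℂφ ⊕ φ^⊥ the operator is off-diagonal, and skewness makes one block determine
the other. So a has rank at most two and is determined by a φ. -/
theorem apply_of_mem_anticommutant {φ : H} (hφ : ‖φ‖ = 1) {a : LieU H}
    (ha : a ∈ anticommutant φ) (w : H) :
    (a : H →L[ℂ] H) w = ⟪φ, w⟫_ℂ • (a : H →L[ℂ] H) φ - ⟪(a : H →L[ℂ] H) φ, w⟫_ℂ • φ := by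
  have h : (reflS φ : H →L[ℂ] H) ((a : H →L[ℂ] H) w) = -((a : H →L[ℂ] H) (reflS φ • w)) :=
    congrArg (fun T : H →L[ℂ] H => T w) ha
  rw [show reflS φ • w = _ from reflS_apply φ w, reflS_apply, map_sub, map_smul,
    rayProj_apply_of_norm_eq_one hφ, rayProj_apply_of_norm_eq_one hφ, map_smul] at h
  rw [inner_lieU_left, neg_smul, sub_neg_eq_add]
  refine smul_right_injective H (two_ne_zero : (2 : ℂ) ≠ 0) ?_
  beta_reduce
  rw [sub_eq_iff_eq_add] at h
  rw [two_smul]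
  nth_rw 1 [h]
  module

/-- The element `|v⟩⟨φ| - |φ⟩⟨v|` of `𝔲(H)`. -/
noncomputable def offDiag (φ v : H) : LieU H :=
  ⟨InnerProductSpace.rankOne ℂ v φ - InnerProductSpace.rankOne ℂ φ v, skewAdjoint.mem_iff.2 (by
    rw [star_sub, ContinuousLinearMap.star_eq_adjoint, ContinuousLinearMap.star_eq_adjoint,
      InnerProductSpace.adjoint_rankOne, InnerProductSpace.adjoint_rankOne, neg_sub])⟩

theorem offDiag_apply (φ v w : H) :
    (offDiag φ v : H →L[ℂ] H) w = ⟪φ, w⟫_ℂ • v - ⟪v, w⟫_ℂ • φ := rfl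

theorem offDiag_apply_self {φ v : H} (hφ : ‖φ‖ = 1) (hv : ⟪φ, v⟫_ℂ = 0) :
    (offDiag φ v : H →L[ℂ] H) φ = v := by
  rw [offDiag_apply, inner_self_eq_norm_sq_to_K, hφ, ← inner_conj_symm v, hv]
  simp

theorem offDiag_mem_anticommutant {φ v : H} (hφ : ‖φ‖ = 1) (hv : ⟪φ, v⟫_ℂ = 0) :
    offDiag φ v ∈ anticommutant φ := by
  have h1 : ⟪φ, φ⟫_ℂ = 1 := by rw [inner_self_eq_norm_sq_to_K, hφ]; simp
  have h2 : ⟪v, φ⟫_ℂ = 0 := by rw [← inner_conj_symm, hv, map_zero]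
  change (reflS φ : H →L[ℂ] H) * (offDiag φ v : H →L[ℂ] H) = -(offDiag φ v * reflS φ)
  ext w
  rw [neg_apply, mul_apply_eq_comp, mul_apply_eq_comp, reflS_apply, reflS_apply,
    rayProj_apply_of_norm_eq_one hφ, rayProj_apply_of_norm_eq_one hφ, offDiag_apply, offDiag_apply]
  simp only [inner_sub_right, inner_smul_right, h1, h2, hv]
  module

end LieAlgebra

/-! ### The differential of the affine chart -/

section AffineDerivative

variable {H : Type u} [NormedAddCommGroup H] [InnerProductSpace ℂ H]

/-- The derivative of the scalar factor contributes a multiple of the projection of φ to φ^⊥, which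
is zero. -/
theorem hasFDerivAt_affineCoord_lift (φ : H) (hφ : ‖φ‖ = 1) :
    HasFDerivAt (fun T : H →L[ℂ] H => (ℂ ∙ φ)ᗮ.orthogonalProjectionOnto ((⟪φ, T φ⟫_ℂ)⁻¹ • T φ))
      ((ℂ ∙ φ)ᗮ.orthogonalProjectionOnto.comp (ContinuousLinearMap.apply ℂ H φ)) 1 := by
  have h1 : ⟪φ, φ⟫_ℂ = 1 := by rw [inner_self_eq_norm_sq_to_K, hφ]; simp
  have h2 : DifferentiableAt ℂ (fun T : H →L[ℂ] H => (⟪φ, T φ⟫_ℂ)⁻¹) 1 := by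
    refine DifferentiableAt.fun_inv ?_ ?_
    · exact ((innerSL ℂ φ).comp (ContinuousLinearMap.apply ℂ H φ)).differentiableAt
    · rw [one_apply_eq_self, h1]
      exact one_ne_zero
  have h3 := (ContinuousLinearMap.hasFDerivAt (ℂ ∙ φ)ᗮ.orthogonalProjectionOnto).comp
    (1 : H →L[ℂ] H) (h2.hasFDerivAt.smul (ContinuousLinearMap.apply ℂ H φ).hasFDerivAt)
  have h4 : (ℂ ∙ φ)ᗮ.orthogonalProjectionOnto φ = 0 :=
    Submodule.orthogonalProjectionOnto_orthogonalComplement_singleton_eq_zero φ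
  refine h3.congr_fderiv ?_
  ext1 T
  simp [hφ, h4]
variable [Nontrivial H]

theorem mdifferentiable_affineChart (φ : H) (hφ : ‖φ‖ = 1) :
    (affineChart φ hφ).MDifferentiable 𝓘(ℝ, PModel H) 𝓘(ℝ, (ℂ ∙ φ)ᗮ) :=
  ⟨fun _ hx => ((contMDiffAt_affineCoord hφ hx).mdifferentiableAt
      (by simp)).mdifferentiableWithinAt,
    fun u _ => ((contMDiff_affineChart_symm hφ).mdifferentiableAt
      (x := u) (by simp)).mdifferentiableWithinAt⟩

theorem hasMFDerivAt_affineCoord (φ : H) (hφ : ‖φ‖ = 1) :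
    HasMFDerivAt 𝓘(ℝ, PModel H) 𝓘(ℝ, (ℂ ∙ φ)ᗮ) (affineCoord φ) (rayOf φ hφ)
      (affineDeriv φ hφ) :=
  ((contMDiffAt_affineCoord hφ (inner_rep_rayOf_ne_zero φ hφ)).mdifferentiableAt
    (by simp)).hasMFDerivAt

/-- The differential of the affine chart as a continuous linear equivalence. -/
noncomputable def affineEquiv (φ : H) (hφ : ‖φ‖ = 1) :
    TangentSpace 𝓘(ℝ, PModel H) (rayOf φ hφ) ≃L[ℝ] (ℂ ∙ φ)ᗮ :=
  (mdifferentiable_affineChart φ hφ).mfderiv (inner_rep_rayOf_ne_zero φ hφ)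

theorem affineEquiv_apply (φ : H) (hφ : ‖φ‖ = 1)
    (v : TangentSpace 𝓘(ℝ, PModel H) (rayOf φ hφ)) :
    affineEquiv φ hφ v = affineDeriv φ hφ v := rfl

theorem affineDeriv_bijective (φ : H) (hφ : ‖φ‖ = 1) : Function.Bijective (affineDeriv φ hφ) :=
  (affineEquiv φ hφ).bijective

/-- J is multiplication by i in the preferred chart, and the change from that chart to b_φ is
holomorphic. -/
theorem affineDeriv_complexStructure (φ : H) (hφ : ‖φ‖ = 1)
    (v : TangentSpace 𝓘(ℝ, PModel H) (rayOf φ hφ)) :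
    affineDeriv φ hφ (complexStructure (rayOf φ hφ) v) = Complex.I • affineDeriv φ hφ v := by
  set c := chartAt (PModel H) (rayOf φ hφ) with hc
  obtain ⟨L⟩ := nonempty_isometry_pModel φ hφ
  have h1 : ContDiffAt ℂ 1 (c.symm.trans (modelChart φ hφ L)) (c (rayOf φ hφ)) := by
    refine (contDiffOn_transition (chart_mem_atlas _ _) (modelChart_mem_atlas φ hφ L)).contDiffAt
      ((c.symm.trans (modelChart φ hφ L)).open_source.mem_nhds ?_)
    refine ⟨c.map_source (mem_chart_source _ _), ?_⟩
    change c.symm (c (rayOf φ hφ)) ∈ (modelChart φ hφ L).source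
    rw [c.left_inv (mem_chart_source _ _)]
    simpa [modelChart, affineChart] using inner_rep_rayOf_ne_zero φ hφ
  have h2 : DifferentiableAt ℂ (affineCoord φ ∘ c.symm) (c (rayOf φ hφ)) := by
    have h3 := (L.symm.differentiableAt).comp _ (h1.differentiableAt one_ne_zero)
    refine h3.congr_of_eventuallyEq (Filter.Eventually.of_forall fun u => ?_)
    exact (L.symm_apply_apply (affineCoord φ (c.symm u))).symm
  let D : PModel H →L[ℝ] (ℂ ∙ φ)ᗮ := affineDeriv φ hφ
  have h4 : HasFDerivAt (affineCoord φ ∘ c.symm) D (c (rayOf φ hφ)) := by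
    have := (hasMFDerivAt_affineCoord φ hφ).2
    simp only [mfld_simps] at this
    exact hasFDerivWithinAt_univ.1 this
  have h5 := h4.unique (h2.hasFDerivAt.restrictScalars ℝ)
  have h6 : ∀ w : PModel H, D w = fderiv ℂ (affineCoord φ ∘ c.symm) (c (rayOf φ hφ)) w :=
    fun w => DFunLike.congr_fun h5 w
  have h7 : ∀ w : PModel H, D (Complex.I • w) = Complex.I • D w := fun w => by
    rw [h6, h6, map_smul]
  exact h7 v

end AffineDerivative

/-! ### The differential of the orbit map -/

section OrbitDerivative

variable {H : Type u} [NormedAddCommGroup H] [InnerProductSpace ℂ H] [CompleteSpace H]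
  [Nontrivial H]

theorem affineDeriv_orbitDeriv (φ : H) (hφ : ‖φ‖ = 1) (a : LieU H) :
    affineDeriv φ hφ (orbitDeriv (rayOf φ hφ) a) =
      (ℂ ∙ φ)ᗮ.orthogonalProjectionOnto ((a : H →L[ℂ] H) φ) := by
  have h1 : HasMFDerivAt 𝓘(ℝ, LieU H) 𝓘(ℝ, PModel H) (fun g : U H => g • rayOf φ hφ) 1
      (orbitDeriv (rayOf φ hφ)) :=
    ((contMDiff_orbit (rayOf φ hφ)).mdifferentiableAt (by simp)).hasMFDerivAt
  -- The chain rule asks for the derivative at 1 • φ̂, which equals φ̂ only propositionally.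
  have h2 : HasMFDerivAt 𝓘(ℝ, PModel H) 𝓘(ℝ, (ℂ ∙ φ)ᗮ) (affineCoord φ)
      ((1 : U H) • rayOf φ hφ) (affineDeriv φ hφ) := by
    have e : (1 : U H) • rayOf φ hφ = rayOf φ hφ := one_smul _ _
    have : ∀ x, (h : x = rayOf φ hφ) → HasMFDerivAt 𝓘(ℝ, PModel H) 𝓘(ℝ, (ℂ ∙ φ)ᗮ)
        (affineCoord φ) x (h ▸ affineDeriv φ hφ) := by
      rintro _ rfl
      exact hasMFDerivAt_affineCoord φ hφ
    exact this _ e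
  have h3 := (((hasFDerivAt_affineCoord_lift φ hφ).restrictScalars ℝ).hasMFDerivAt).comp
    (1 : U H) (hasMFDerivAt_coe_unitary_one (A := H →L[ℂ] H))
  have h4 := h3.congr_of_eventuallyEq (f₁ := affineCoord φ ∘ fun g : U H => g • rayOf φ hφ)
    (Filter.Eventually.of_forall fun g => affineCoord_mk φ _ _)
  exact DFunLike.congr_fun (hasMFDerivAt_unique (h2.comp (1 : U H) h1) h4) a

/-- The component of a φ in φ^⊥ vanishes iff φ is an eigenvector of a. -/
theorem orbitDeriv_eq_zero_iff (φ : H) (hφ : ‖φ‖ = 1) (a : LieU H) :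
    orbitDeriv (rayOf φ hφ) a = 0 ↔ a ∈ commutant φ := by
  rw [← map_eq_zero_iff (affineEquiv φ hφ) (affineEquiv φ hφ).injective, affineEquiv_apply,
    affineDeriv_orbitDeriv, Submodule.orthogonalProjectionOnto_eq_zero_iff,
    Submodule.orthogonal_orthogonal, Submodule.mem_span_singleton,
    mem_commutant_iff_exists_smul φ hφ]
  exact exists_congr fun c => eq_comm

theorem coe_affineDeriv_orbitDeriv {φ : H} (hφ : ‖φ‖ = 1) {a : LieU H}
    (ha : a ∈ anticommutant φ) :
    (affineDeriv φ hφ (orbitDeriv (rayOf φ hφ) a) : H) = (a : H →L[ℂ] H) φ := by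
  rw [affineDeriv_orbitDeriv]
  refine Submodule.starProjection_eq_self_iff.2 ?_
  exact Submodule.mem_orthogonal_singleton_iff_inner_right.2
    (inner_apply_of_mem_anticommutant hφ ha)

theorem orbitDeriv_bijective (φ : H) (hφ : ‖φ‖ = 1) :
    Function.Bijective (fun a : anticommutant φ => orbitDeriv (rayOf φ hφ) a) := by
  constructor
  · intro a b h
    have h1 : orbitDeriv (rayOf φ hφ) ((a : LieU H) - b) = 0 := by
      rw [map_sub, sub_eq_zero]
      exact h
    rw [orbitDeriv_eq_zero_iff] at h1
    have h2 := Submodule.disjoint_def.1 (isCompl_commutant_anticommutant φ).disjoint _ h1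
      (Submodule.sub_mem _ a.2 b.2)
    exact Subtype.ext (sub_eq_zero.1 h2)
  · intro v
    have h0 := Submodule.mem_orthogonal_singleton_iff_inner_right.1 (affineDeriv φ hφ v).2
    -- The preimage is the off-diagonal operator that sends φ to the coordinate of v.
    refine ⟨⟨offDiag φ (affineDeriv φ hφ v : H), offDiag_mem_anticommutant hφ h0⟩, ?_⟩
    refine (affineDeriv_bijective φ hφ).1 (Subtype.ext ?_)
    refine (coe_affineDeriv_orbitDeriv hφ (offDiag_mem_anticommutant hφ h0)).trans ?_
    exact offDiag_apply_self hφ h0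

theorem orbitDeriv_complexStructure {φ : H} (hφ : ‖φ‖ = 1) {a b : LieU H}
    (ha : a ∈ anticommutant φ) (hb : b ∈ anticommutant φ)
    (h : (b : H →L[ℂ] H) φ = Complex.I • (a : H →L[ℂ] H) φ) :
    orbitDeriv (rayOf φ hφ) b = complexStructure _ (orbitDeriv (rayOf φ hφ) a) := by
  refine (affineDeriv_bijective φ hφ).1 (Subtype.ext ?_)
  rw [affineDeriv_complexStructure, Submodule.coe_smul, coe_affineDeriv_orbitDeriv hφ ha,
    coe_affineDeriv_orbitDeriv hφ hb, h]

end OrbitDerivative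

/-! ### Smooth fields of bilinear forms -/

/-- The continuous bilinear forms on a normed space. -/
abbrev BilinModel (F : Type*) [NormedAddCommGroup F] [NormedSpace ℝ F] := F →L[ℝ] F →L[ℝ] ℝ

/-- A field of bilinear forms is smooth at a point if its expression in the preferred chart is. -/
theorem contMDiffAt_bilinForm_of_chart {F M : Type*} [NormedAddCommGroup F] [NormedSpace ℝ F]
    [TopologicalSpace M] [ChartedSpace F M] [IsManifold 𝓘(ℝ, F) ∞ M]
    (B : ∀ x : M, TangentSpace 𝓘(ℝ, F) x →L[ℝ] TangentSpace 𝓘(ℝ, F) x →L[ℝ] ℝ) (x₀ : M)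
    {G : F → BilinModel F} (hG : ContDiff ℝ ∞ G)
    (h : ∀ x ∈ (chartAt F x₀).source, ∀ D : F →L[ℝ] TangentSpace 𝓘(ℝ, F) x,
      HasMFDerivAt 𝓘(ℝ, F) 𝓘(ℝ, F) (chartAt F x₀).symm (chartAt F x₀ x) D →
        ∀ v w : F, B x (D v) (D w) = G (chartAt F x₀ x) v w) :
    ContMDiffAt 𝓘(ℝ, F) (𝓘(ℝ, F).prod 𝓘(ℝ, BilinModel F)) ∞
      (fun x : M => Bundle.TotalSpace.mk' (BilinModel F)
        (E := fun x : M => TangentSpace 𝓘(ℝ, F) x →L[ℝ] TangentSpace 𝓘(ℝ, F) x →L[ℝ] ℝ)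
        x (B x)) x₀ := by
  rw [contMDiffAt_hom_bundle]
  refine ⟨contMDiffAt_id, ?_⟩
  have hcs : ContMDiffAt 𝓘(ℝ, F) 𝓘(ℝ, F) ∞ (chartAt F x₀) x₀ := contMDiffAt_extChartAt
  refine (hG.contMDiff.contMDiffAt.comp x₀ hcs).congr_of_eventuallyEq ?_
  filter_upwards [(chartAt F x₀).open_source.mem_nhds (mem_chart_source _ x₀)] with x hx
  -- The inverse of the tangent bundle trivialization is the differential of the inverse chart, so
  -- the bundle coordinates of B are its pullback to the chart.
  have hD : HasMFDerivAt 𝓘(ℝ, F) 𝓘(ℝ, F) (chartAt F x₀).symm (chartAt F x₀ x)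
      ((trivializationAt F (TangentSpace 𝓘(ℝ, F)) x₀).symmL ℝ x) := by
    have h1 := (mdifferentiableAt_atlas_symm (I := 𝓘(ℝ, F)) (chart_mem_atlas F x₀)
      ((chartAt F x₀).map_source hx)).hasMFDerivAt
    refine h1.congr_mfderiv ?_
    refine Eq.trans ?_ (TangentBundle.symmL_trivializationAt hx).symm
    simp only [mfld_simps, mfderivWithin_univ]
  ext v w
  refine (inCoordinates_apply_eq₂ (F₃ := ℝ) (E₃ := Bundle.Trivial M ℝ) hx hx
    (Set.mem_univ _)).trans ?_
  refine (congrFun (Bundle.Trivialization.coe_linearMapAt_of_mem (R := ℝ)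
    (trivializationAt ℝ (Bundle.Trivial M ℝ) x₀) (Set.mem_univ x)) _).trans ?_
  have hs : ∀ z, (trivializationAt F (TangentSpace 𝓘(ℝ, F)) x₀).symm x z =
      (trivializationAt F (TangentSpace 𝓘(ℝ, F)) x₀).symmL ℝ x z :=
    fun z => (Bundle.Trivialization.symmL_apply (R := ℝ) _ hx z).symm
  rw [hs, hs]
  exact h x hx _ hD v w

/-! ### Real bilinear tools on a complex Hilbert space -/

section RealInner

variable {H : Type u} [NormedAddCommGroup H] [InnerProductSpace ℂ H]

variable (H) in
/-- The real part of the inner product, as a continuous real bilinear map. -/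
noncomputable def reInner : H →L[ℝ] H →L[ℝ] ℝ :=
  (ContinuousLinearMap.compL ℝ H ℂ ℝ Complex.reCLM).comp
    (isBoundedBilinearMap_inner (𝕜 := ℂ) (E := H)).toContinuousLinearMap

theorem reInner_apply (v w : H) : reInner H v w = (⟪v, w⟫_ℂ).re := rfl

theorem reInner_self (v : H) : reInner H v v = ‖v‖ ^ 2 :=
  inner_self_eq_norm_sq (𝕜 := ℂ) v

/-- The pullback of the real scalar product along a linear map. -/
noncomputable def pullInner {E : Type*} [NormedAddCommGroup E] [NormedSpace ℝ E]
    (θ : E →L[ℝ] H) : E →L[ℝ] E →L[ℝ] ℝ :=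
  ((ContinuousLinearMap.compL ℝ E H ℝ).flip θ).comp ((reInner H).comp θ)

theorem contDiff_smul_pullInner {E F : Type*} [NormedAddCommGroup E] [NormedSpace ℝ E]
    [NormedAddCommGroup F] [NormedSpace ℝ F] {n : ℕ∞ω} {f : F → ℝ} {θ : F → E →L[ℝ] H}
    (hf : ContDiff ℝ n f) (hθ : ContDiff ℝ n θ) :
    ContDiff ℝ n (fun u => f u • pullInner (θ u)) := by
  have h1 : ContDiff ℝ n fun T : E →L[ℝ] H => (ContinuousLinearMap.compL ℝ E H ℝ).flip T :=
    ContinuousLinearMap.contDiff (𝕜 := ℝ) (F := (H →L[ℝ] ℝ) →L[ℝ] (E →L[ℝ] ℝ))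
      (ContinuousLinearMap.compL ℝ E H ℝ).flip
  have h2 : ContDiff ℝ n fun u => ((ContinuousLinearMap.compL ℝ E H ℝ).flip (θ u)).comp
      ((reInner H).comp (f u • θ u)) :=
    (h1.comp hθ).clm_comp (contDiff_const.clm_comp (hf.smul hθ))
  have e : (fun u => f u • pullInner (θ u)) = fun u =>
      ((ContinuousLinearMap.compL ℝ E H ℝ).flip (θ u)).comp ((reInner H).comp (f u • θ u)) := by
    ext u v w
    change f u * reInner H (θ u v) (θ u w) = reInner H (f u • θ u v) (θ u w)
    rw [map_smul]
    rfl
  rw [e]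
  exact h2

variable (H) in
/-- Evaluation of complex linear operators at a vector, as a continuous real bilinear map. -/
noncomputable def evalL : H →L[ℝ] (H →L[ℂ] H) →L[ℝ] H :=
  LinearMap.mkContinuous₂ (LinearMap.mk₂ ℝ (fun (v : H) (T : H →L[ℂ] H) => T v)
    (fun v w T => map_add T v w) (fun c v T => T.map_smul_of_tower c v)
    (fun v S T => rfl) (fun c v T => rfl)) 1
    (fun v T => by simpa [mul_comm] using T.le_opNorm v)

theorem evalL_apply (v : H) (T : H →L[ℂ] H) : evalL H v T = T v := rfl

theorem contDiff_evalL {n : ℕ∞ω} : ContDiff ℝ n (fun v : H => evalL H v) :=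
  ContinuousLinearMap.contDiff (𝕜 := ℝ) (F := (H →L[ℂ] H) →L[ℝ] H) (evalL H)

end RealInner

/-! ### The trace form on 𝔪 -/

section Trace

variable {H : Type u} [NormedAddCommGroup H] [InnerProductSpace ℂ H]

theorem hasTrace_rankOne (x y : H) :
    HasTrace (InnerProductSpace.rankOne ℂ x y) ⟪y, x⟫_ℂ := by
  intro ι b
  refine (b.hasSum_inner_mul_inner y x).congr_fun fun i => ?_
  rw [InnerProductSpace.rankOne_apply, inner_smul_right]

theorem HasTrace.add {S T : H →L[ℂ] H} {s t : ℂ} (hS : HasTrace S s) (hT : HasTrace T t) :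
    HasTrace (S + T) (s + t) := by
  intro ι b
  refine ((hS ι b).add (hT ι b)).congr_fun fun i => ?_
  rw [add_apply, inner_add_right]

theorem HasTrace.smul {T : H →L[ℂ] H} {t : ℂ} (hT : HasTrace T t) (c : ℂ) :
    HasTrace (c • T) (c * t) := by
  intro ι b
  refine ((hT ι b).mul_left c).congr_fun fun i => ?_
  rw [smul_apply, inner_smul_right]

variable [CompleteSpace H]

/-- With v = aφ and w = bφ, ab = -⟨v, w⟩ |φ⟩⟨φ| - |v⟩⟨w|, whose trace is -⟨v, w⟩ - ⟨w, v⟩. -/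
theorem hasTrace_mul_of_mem_anticommutant {φ : H} (hφ : ‖φ‖ = 1) {a b : LieU H}
    (ha : a ∈ anticommutant φ) (hb : b ∈ anticommutant φ) :
    HasTrace ((a : H →L[ℂ] H) * (b : H →L[ℂ] H))
      ((-2 * (⟪(a : H →L[ℂ] H) φ, (b : H →L[ℂ] H) φ⟫_ℂ).re : ℝ) : ℂ) := by
  set v := (a : H →L[ℂ] H) φ with hv
  set w := (b : H →L[ℂ] H) φ with hw
  have hφw : ⟪φ, w⟫_ℂ = 0 := inner_apply_of_mem_anticommutant hφ hb
  have h1 : ⟪φ, φ⟫_ℂ = 1 := by rw [inner_self_eq_norm_sq_to_K, hφ]; simp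
  have e : (a : H →L[ℂ] H) * (b : H →L[ℂ] H) =
      (-⟪v, w⟫_ℂ) • InnerProductSpace.rankOne ℂ φ φ +
        (-1 : ℂ) • InnerProductSpace.rankOne ℂ v w := by
    ext z
    rw [mul_apply_eq_comp, apply_of_mem_anticommutant hφ hb z, map_sub, map_smul, map_smul,
      ← hv, ← hw, apply_of_mem_anticommutant hφ ha w, hφw, add_apply, smul_apply, smul_apply,
      InnerProductSpace.rankOne_apply, InnerProductSpace.rankOne_apply]
    module
  rw [e]
  convert ((hasTrace_rankOne φ φ).smul _).add ((hasTrace_rankOne v w).smul _) using 1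
  rw [h1, ← inner_conj_symm w v]
  have := Complex.add_conj ⟪v, w⟫_ℂ
  push_cast at this ⊢
  linear_combination this

/-- The evaluation `A ↦ A φ` on `𝔪`. -/
noncomputable def evalAnti (φ : H) : anticommutant φ →L[ℝ] H :=
  (evalL H φ).comp
    ((skewAdjoint.submodule ℝ (H →L[ℂ] H)).subtypeL.comp (anticommutant φ).subtypeL)

/-- The scalar product `(A, B) ↦ -κ Tr (A B) = 2 κ Re ⟪A φ, B φ⟫` of `𝔪`. -/
noncomputable def traceForm (κ : ℝ) (φ : H) : anticommutant φ →L[ℝ] anticommutant φ →L[ℝ] ℝ :=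
  (2 * κ) • pullInner (E := anticommutant φ) (evalAnti φ)

theorem traceForm_apply (κ : ℝ) (φ : H) (a b : anticommutant φ) :
    traceForm κ φ a b =
      2 * κ * (⟪((a : LieU H) : H →L[ℂ] H) φ, ((b : LieU H) : H →L[ℂ] H) φ⟫_ℂ).re := rfl

theorem traceForm_symm (κ : ℝ) (φ : H) (a b : anticommutant φ) :
    traceForm κ φ a b = traceForm κ φ b a := by
  rw [traceForm_apply, traceForm_apply, ← inner_conj_symm, Complex.conj_re]

theorem traceForm_pos {κ : ℝ} (hκ : 0 < κ) {φ : H} (hφ : ‖φ‖ = 1) {a : anticommutant φ}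
    (ha : a ≠ 0) : 0 < traceForm κ φ a a := by
  have h : ((a : LieU H) : H →L[ℂ] H) φ ≠ 0 := by
    intro h
    refine ha (Subtype.ext (Subtype.ext ?_))
    ext w
    rw [apply_of_mem_anticommutant hφ a.2 w, h]
    simp
  have h2 : 0 < ‖((a : LieU H) : H →L[ℂ] H) φ‖ ^ 2 := by positivity
  rw [traceForm_apply, ← reInner_apply, reInner_self]
  positivity

/-- g⁻¹ φ = c φ with |c| = 1; the phase cancels in the scalar product and g is isometric. -/
theorem traceForm_AdL (κ : ℝ) {φ : H} (hφ : ‖φ‖ = 1) {g : U H}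
    (hg : g ∈ MulAction.stabilizer (U H) (rayOf φ hφ)) {a b a' b' : anticommutant φ}
    (ha : (a' : LieU H) = AdL g a) (hb : (b' : LieU H) = AdL g b) :
    traceForm κ φ a' b' = traceForm κ φ a b := by
  obtain ⟨c, hc⟩ := (mem_stabilizer_iff_exists_smul φ hφ g⁻¹).1 (inv_mem hg)
  have hc' : star (g : H →L[ℂ] H) φ = c • φ := hc
  have hn : starRingEnd ℂ c * c = 1 := by
    have := Unitary.norm_map g⁻¹ φ
    rw [hc, norm_smul, hφ, mul_one] at this
    rw [Complex.conj_mul', this]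
    simp
  have h : ∀ d : LieU H, (AdL g d : H →L[ℂ] H) φ = c • (g : H →L[ℂ] H) ((d : H →L[ℂ] H) φ) := by
    intro d
    rw [coe_AdL, mul_apply_eq_comp, mul_apply_eq_comp, hc', map_smul, map_smul]
  rw [traceForm_apply, traceForm_apply, ha, hb, h, h, inner_smul_left, inner_smul_right,
    ← mul_assoc, hn, one_mul, Unitary.inner_map_map]

end Trace

/-! ### The Fubini–Study form through the differential of x ↦ P_x -/

section FubiniStudy

variable {H : Type u} [NormedAddCommGroup H] [InnerProductSpace ℂ H] [Nontrivial H]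

/-- The differential of `x ↦ P_x`. -/
noncomputable def projDeriv (x : ℙ ℂ H) :
    TangentSpace 𝓘(ℝ, PModel H) x →L[ℝ] (H →L[ℂ] H) :=
  mfderiv 𝓘(ℝ, PModel H) 𝓘(ℝ, H →L[ℂ] H) projOf x

theorem hasMFDerivAt_projOf (x : ℙ ℂ H) :
    HasMFDerivAt 𝓘(ℝ, PModel H) 𝓘(ℝ, H →L[ℂ] H) projOf x (projDeriv x) :=
  (contMDiff_projOf.mdifferentiableAt (by simp)).hasMFDerivAt

/-- In the chart, P_{φ+u} φ = (φ + u)/(1 + ‖u‖²). The denominator is minimal at u = 0, so only the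
derivative of u survives. -/
theorem projDeriv_apply_self (φ : H) (hφ : ‖φ‖ = 1)
    (v : TangentSpace 𝓘(ℝ, PModel H) (rayOf φ hφ)) :
    projDeriv (rayOf φ hφ) v φ = affineDeriv φ hφ v := by
  let j : (ℂ ∙ φ)ᗮ →L[ℝ] H := (ℂ ∙ φ)ᗮ.subtypeL.restrictScalars ℝ
  have h1 : HasFDerivAt (fun u : (ℂ ∙ φ)ᗮ => (1 + ‖u‖ ^ 2)⁻¹ • (φ + (u : H))) j 0 := by
    have h2 : HasFDerivAt (fun u : (ℂ ∙ φ)ᗮ => 1 + ‖u‖ ^ 2) (0 : (ℂ ∙ φ)ᗮ →L[ℝ] ℝ) 0 := by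
      have h := ((contDiff_const.add (contDiff_norm_sq ℂ (n := 1) (E := (ℂ ∙ φ)ᗮ))).differentiable
        one_ne_zero 0 : DifferentiableAt ℝ (fun u : (ℂ ∙ φ)ᗮ => 1 + ‖u‖ ^ 2) 0).hasFDerivAt
      have hmin : IsLocalMin (fun u : (ℂ ∙ φ)ᗮ => 1 + ‖u‖ ^ 2) 0 :=
        Filter.Eventually.of_forall fun u => by simp
      exact hmin.hasFDerivAt_eq_zero h ▸ h
    have h3 : HasFDerivAt (fun u : (ℂ ∙ φ)ᗮ => (1 + ‖u‖ ^ 2)⁻¹) (0 : (ℂ ∙ φ)ᗮ →L[ℝ] ℝ) 0 := by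
      refine (HasDerivAt.comp_hasFDerivAt (0 : (ℂ ∙ φ)ᗮ) (hasDerivAt_inv ?_) h2).congr_fderiv ?_
      · simp
      · simp
    refine (h3.smul (j.hasFDerivAt.const_add φ)).congr_fderiv ?_
    ext u
    simp
  have h4 : HasMFDerivAt 𝓘(ℝ, (ℂ ∙ φ)ᗮ) 𝓘(ℝ, H)
      (fun u : (ℂ ∙ φ)ᗮ => (1 + ‖u‖ ^ 2)⁻¹ • (φ + (u : H))) (affineCoord φ (rayOf φ hφ)) j := by
    rw [affineCoord_rayOf]
    exact h1.hasMFDerivAt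
  have h5 := h4.comp (rayOf φ hφ) (hasMFDerivAt_affineCoord φ hφ)
  have h6 := HasMFDerivAt.comp (rayOf φ hφ) (g := evalL H φ)
    ((evalL H φ).hasFDerivAt.hasMFDerivAt) (hasMFDerivAt_projOf (rayOf φ hφ))
  refine DFunLike.congr_fun (hasMFDerivAt_unique h6 (h5.congr_of_eventuallyEq ?_)) v
  filter_upwards [(isOpen_inner_rep_ne_zero φ).mem_nhds (inner_rep_rayOf_ne_zero φ hφ)] with x hx
  have hs := add_orthogonal_ne_zero φ hφ (affineCoord φ x)
  have h7 : projOf x = rayProj (φ + (affineCoord φ x : H)) := by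
    rw [← projOf_mk _ hs, mk_add_affineCoord φ hφ hx]
  have h8 : ‖φ + (affineCoord φ x : H)‖ ^ 2 = 1 + ‖affineCoord φ x‖ ^ 2 := by
    have := norm_add_sq (𝕜 := ℂ) φ (affineCoord φ x : H)
    rw [Submodule.mem_orthogonal_singleton_iff_inner_right.1 (affineCoord φ x).2, hφ] at this
    simpa using this
  rw [Function.comp_apply, Function.comp_apply, evalL_apply, h7, rayProj_apply,
    ← inner_conj_symm, inner_add_orthogonal φ hφ, h8, map_one, one_div, ← Complex.ofReal_inv,
    Complex.coe_smul]

/-- A unit vector in a ray. -/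
noncomputable def unitRep (x : ℙ ℂ H) : H := (exists_norm_eq_one_eq_rayOf x).choose

/-- The bilinear form `κ Tr (dP v dP w) = 2 κ Re ⟪(dP v) φ, (dP w) φ⟫` at the ray of the unit
vector `φ`. -/
noncomputable def fubiniStudyForm (κ : ℝ) (x : ℙ ℂ H) : TangentSpace 𝓘(ℝ, PModel H) x →L[ℝ]
    TangentSpace 𝓘(ℝ, PModel H) x →L[ℝ] ℝ :=
  (2 * κ) • pullInner (E := PModel H) ((evalL H (unitRep x)).comp (projDeriv x))

/-- `unitRep` is an arbitrary choice, not continuous in x. Any nonzero vector of the ray may replace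
it after normalization, in particular a smooth local section or the image of a vector under g. -/
theorem fubiniStudyForm_apply (κ : ℝ) {x : ℙ ℂ H} {s : H} (hs : s ≠ 0)
    (hx : x = Projectivization.mk ℂ s hs) (v w : TangentSpace 𝓘(ℝ, PModel H) x) :
    fubiniStudyForm κ x v w =
      2 * κ * (‖s‖ ^ 2)⁻¹ * (⟪projDeriv x v s, projDeriv x w s⟫_ℂ).re := by
  obtain ⟨hn, hxn⟩ := (exists_norm_eq_one_eq_rayOf x).choose_spec
  change ‖unitRep x‖ = 1 at hn
  change x = rayOf (unitRep x) hn at hxn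
  obtain ⟨c, hc⟩ := (Projectivization.mk_eq_mk_iff' ..).1 (hx.symm.trans hxn)
  have hcs : ‖c‖ = ‖s‖ := by rw [← hc, norm_smul, hn, mul_one]
  have e : fubiniStudyForm κ x v w =
      2 * κ * (⟪projDeriv x v (unitRep x), projDeriv x w (unitRep x)⟫_ℂ).re := rfl
  rw [e, ← hc, map_smul, map_smul, inner_smul_left, inner_smul_right, ← mul_assoc _ c,
    Complex.conj_mul', ← Complex.ofReal_pow, Complex.re_ofReal_mul, norm_smul, hn, mul_one]
  have hc0 : ‖c‖ ≠ 0 := by rw [hcs]; exact norm_ne_zero_iff.2 hs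
  field_simp

theorem fubiniStudyForm_rayOf (κ : ℝ) (φ : H) (hφ : ‖φ‖ = 1)
    (v w : TangentSpace 𝓘(ℝ, PModel H) (rayOf φ hφ)) :
    fubiniStudyForm κ (rayOf φ hφ) v w =
      2 * κ * (⟪affineDeriv φ hφ v, affineDeriv φ hφ w⟫_ℂ).re := by
  refine (fubiniStudyForm_apply κ _ rfl v w).trans ?_
  have h1 : projDeriv (rayOf φ hφ) v φ = affineDeriv φ hφ v := projDeriv_apply_self φ hφ v
  have h2 : projDeriv (rayOf φ hφ) w φ = affineDeriv φ hφ w := projDeriv_apply_self φ hφ w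
  rw [hφ, one_pow, inv_one, mul_one]
  congr 2
  exact congrArg₂ (fun p q : H => ⟪p, q⟫_ℂ) h1 h2

theorem projDeriv_comp_eq_fderiv {F : Type*} [NormedAddCommGroup F] [NormedSpace ℝ F]
    (γ : F → ℙ ℂ H) {u : F} {x : ℙ ℂ H} (hx : γ u = x)
    {D : F →L[ℝ] TangentSpace 𝓘(ℝ, PModel H) x}
    (hD : HasMFDerivAt 𝓘(ℝ, F) 𝓘(ℝ, PModel H) γ u D) {Q : F → H →L[ℂ] H}
    (hQ : ∀ u, Q u = projOf (γ u)) (w : F) : projDeriv x (D w) = fderiv ℝ Q u w := by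
  subst hx
  have h1 := ((hasMFDerivAt_projOf (γ u)).comp u hD).congr_of_eventuallyEq (f₁ := Q)
    (Filter.Eventually.of_forall hQ)
  have h2 : HasFDerivAt Q (E := F) ((projDeriv (γ u)).comp D) u := h1.hasFDerivAt
  exact (DFunLike.congr_fun h2.fderiv w).symm

theorem contMDiff_fubiniStudyForm (κ : ℝ) :
    ContMDiff 𝓘(ℝ, PModel H) (𝓘(ℝ, PModel H).prod 𝓘(ℝ, BilinModel (PModel H))) ∞
      (fun x : ℙ ℂ H => Bundle.TotalSpace.mk' (BilinModel (PModel H))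
        (E := fun x : ℙ ℂ H => TangentSpace 𝓘(ℝ, PModel H) x →L[ℝ]
          TangentSpace 𝓘(ℝ, PModel H) x →L[ℝ] ℝ) x (fubiniStudyForm κ x)) := by
  intro x₀
  obtain ⟨φ, hφ, L, hL⟩ := chart_mem_atlas (PModel H) x₀
  -- A smooth section of nonzero vectors over the whole chart; with it the form is an explicit
  -- smooth function of the coordinate.
  let σ : PModel H → H := fun u => φ + (L.symm u : H)
  have hσ0 : ∀ u, σ u ≠ 0 := fun u => add_orthogonal_ne_zero φ hφ _
  have hσc : ∀ u, (chartAt (PModel H) x₀).symm u = Projectivization.mk ℂ (σ u) (hσ0 u) :=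
    fun u => by
      rw [hL]
      rfl
  have hσ : ContDiff ℝ ∞ σ := contDiff_const.add
    (((ℂ ∙ φ)ᗮ.subtypeL.contDiff.comp L.symm.contDiff).restrict_scalars ℝ)
  have hQ : ContDiff ℝ ∞ fun u => rayProj (σ u) := contDiff_iff_contDiffAt.2 fun u =>
    (contDiffAt_rayProj (hσ0 u)).comp u hσ.contDiffAt
  have hG : ContDiff ℝ ∞ fun u => (2 * κ * (‖σ u‖ ^ 2)⁻¹) •
      pullInner ((evalL H (σ u)).comp (fderiv ℝ (fun u => rayProj (σ u)) u)) :=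
    contDiff_smul_pullInner
      (contDiff_const.mul (((contDiff_norm_sq ℂ).comp hσ).inv fun u => by simpa using hσ0 u))
      ((contDiff_evalL.comp hσ).clm_comp (hQ.fderiv_right (by simp)))
  refine contMDiffAt_bilinForm_of_chart (fubiniStudyForm κ) x₀ hG fun x hx D hD v w => ?_
  have hx' : x = Projectivization.mk ℂ (σ (chartAt (PModel H) x₀ x)) (hσ0 _) := by
    rw [← hσc, (chartAt (PModel H) x₀).left_inv hx]
  have hfd := projDeriv_comp_eq_fderiv (chartAt (PModel H) x₀).symm
    ((chartAt (PModel H) x₀).left_inv hx) hD (Q := fun u => rayProj (σ u))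
    fun u => by rw [hσc, projOf_mk]
  rw [fubiniStudyForm_apply κ (hσ0 _) hx', hfd, hfd]
  rfl

end FubiniStudy

/-! ### The invariant metric and its uniqueness -/

section FubiniStudyMetric

variable {H : Type u} [NormedAddCommGroup H] [InnerProductSpace ℂ H] [Nontrivial H]

/-- The Fubini-Study metric with constant `κ`. -/
noncomputable def fubiniStudyMetric (κ : ℝ) (hκ : 0 < κ) : ProjMetric H where
  inner := fubiniStudyForm κ
  symm x v w := by
    obtain ⟨φ, hφ, rfl⟩ := exists_norm_eq_one_eq_rayOf x
    rw [fubiniStudyForm_rayOf, fubiniStudyForm_rayOf, Submodule.coe_inner, Submodule.coe_inner,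
      ← inner_conj_symm, Complex.conj_re]
  pos x v hv := by
    obtain ⟨φ, hφ, rfl⟩ := exists_norm_eq_one_eq_rayOf x
    have h : affineEquiv φ hφ v ≠ 0 := by simpa using hv
    have h2 : 0 < ‖affineEquiv φ hφ v‖ ^ 2 := by positivity
    rw [fubiniStudyForm_rayOf, ← affineEquiv_apply, ← reInner_apply, reInner_self]
    positivity
  isVonNBounded x := by
    obtain ⟨φ, hφ, rfl⟩ := exists_norm_eq_one_eq_rayOf x
    -- 2κ‖T b_φ v‖² < 1 means that T b_φ v lies in the ball of radius (2κ)^(-1/2).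
    have h := (NormedSpace.isVonNBounded_ball ℝ (ℂ ∙ φ)ᗮ (√((2 * κ)⁻¹))).image
      ((affineEquiv φ hφ).symm : (ℂ ∙ φ)ᗮ →L[ℝ] TangentSpace 𝓘(ℝ, PModel H) (rayOf φ hφ))
    refine h.subset ?_
    intro v hv
    refine ⟨affineEquiv φ hφ v, ?_, (affineEquiv φ hφ).symm_apply_apply v⟩
    have hv' : fubiniStudyForm κ (rayOf φ hφ) v v < 1 := hv
    rw [fubiniStudyForm_rayOf, ← affineEquiv_apply, ← reInner_apply, reInner_self] at hv'
    rw [mem_ball_zero_iff, Real.lt_sqrt (norm_nonneg _), inv_eq_one_div, lt_div_iff₀' (by positivity)]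
    exact hv'
  contMDiff := contMDiff_fubiniStudyForm κ

theorem isFubiniStudy_fubiniStudyMetric (κ : ℝ) (hκ : 0 < κ) :
    IsFubiniStudy κ (fubiniStudyMetric κ hκ : ProjMetric H) :=
  fun φ hφ v w => fubiniStudyForm_rayOf κ φ hφ v w

variable [CompleteSpace H]

theorem projDeriv_smul (g : U H) (x : ℙ ℂ H) (v : TangentSpace 𝓘(ℝ, PModel H) x) :
    projDeriv (g • x) (mfderiv 𝓘(ℝ, PModel H) 𝓘(ℝ, PModel H) (fun y : ℙ ℂ H => g • y) x v) =
      g * projDeriv x v * star (g : H →L[ℂ] H) := by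
  let C : (H →L[ℂ] H) →L[ℝ] (H →L[ℂ] H) :=
    (ContinuousLinearMap.mul ℝ (H →L[ℂ] H) g).comp
      ((ContinuousLinearMap.mul ℝ (H →L[ℂ] H)).flip (star (g : H →L[ℂ] H)))
  have hC : ∀ T, C T = g * T * star (g : H →L[ℂ] H) := fun T => by simp [C, mul_assoc]
  have h1 := ((contMDiff_unitary_smul_left g).mdifferentiableAt (x := x) (by simp)).hasMFDerivAt
  have h2 := (hasMFDerivAt_projOf (g • x)).comp x h1
  have h3 := HasMFDerivAt.comp x (g := C) (C.hasFDerivAt.hasMFDerivAt) (hasMFDerivAt_projOf x)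
  have h4 := h3.congr_of_eventuallyEq (f₁ := projOf ∘ fun y : ℙ ℂ H => g • y)
    (Filter.Eventually.of_forall fun y => (projOf_smul g y).trans (hC _).symm)
  exact (DFunLike.congr_fun (hasMFDerivAt_unique h2 h4) v).trans (hC _)

/-- If s spans x, then g s spans g x and (g dP(v) g*)(g s) = g (dP(v) s), so both sides agree
because g is isometric. -/
theorem isInvariantMetric_fubiniStudyMetric (κ : ℝ) (hκ : 0 < κ) :
    IsInvariantMetric (fubiniStudyMetric κ hκ : ProjMetric H) := by
  intro g x v w
  obtain ⟨s, hs, rfl⟩ : ∃ s : H, ∃ hs : s ≠ 0, x = Projectivization.mk ℂ s hs :=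
    ⟨x.rep, x.rep_nonzero, x.mk_rep.symm⟩
  refine (fubiniStudyForm_apply κ (unitary_apply_ne_zero g hs) (unitary_smul_mk g s hs) _ _).trans
    (Eq.trans ?_ (fubiniStudyForm_apply κ hs rfl v w).symm)
  rw [projDeriv_smul, projDeriv_smul, Unitary.norm_map]
  simp only [mul_apply_eq_comp, star_apply_apply, Unitary.inner_map_map]

theorem isInducedMetric_fubiniStudyMetric (κ : ℝ) (hκ : 0 < κ) (φ : H) (hφ : ‖φ‖ = 1) :
    IsInducedMetric φ hφ (traceForm κ φ) (fubiniStudyMetric κ hκ) := by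
  refine ⟨isInvariantMetric_fubiniStudyMetric κ hκ, fun a b => ?_⟩
  rw [isFubiniStudy_fubiniStudyMetric κ hκ φ hφ, traceForm_apply, Submodule.coe_inner,
    coe_affineDeriv_orbitDeriv hφ a.2, coe_affineDeriv_orbitDeriv hφ b.2]

theorem surjective_mfderiv_smul (g : U H) (x : ℙ ℂ H) : Function.Surjective
    (mfderiv 𝓘(ℝ, PModel H) 𝓘(ℝ, PModel H) (fun y : ℙ ℂ H => g • y) x) := by
  let e := (Homeomorph.smul g : ℙ ℂ H ≃ₜ ℙ ℂ H).toOpenPartialHomeomorph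
  have he : e.MDifferentiable 𝓘(ℝ, PModel H) 𝓘(ℝ, PModel H) :=
    ⟨((contMDiff_unitary_smul_left g).mdifferentiable (by simp)).mdifferentiableOn,
      ((contMDiff_unitary_smul_left g⁻¹).mdifferentiable (by simp)).mdifferentiableOn⟩
  exact he.mfderiv_surjective (Set.mem_univ x)

/-- An invariant metric is determined by its value at one point. -/
theorem eq_of_isInducedMetric {φ : H} {hφ : ‖φ‖ = 1}
    {β : anticommutant φ →L[ℝ] anticommutant φ →L[ℝ] ℝ} {m m' : ProjMetric H}
    (hm : IsInducedMetric φ hφ β m) (hm' : IsInducedMetric φ hφ β m') : m = m' := by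
  have h : m.inner = m'.inner := by
    funext x
    obtain ⟨g, rfl⟩ := MulAction.exists_smul_eq (U H) (rayOf φ hφ) x
    refine ContinuousLinearMap.ext fun v => ContinuousLinearMap.ext fun w => ?_
    obtain ⟨v, rfl⟩ := surjective_mfderiv_smul g (rayOf φ hφ) v
    obtain ⟨w, rfl⟩ := surjective_mfderiv_smul g (rayOf φ hφ) w
    rw [hm.1, hm'.1]
    obtain ⟨a, rfl⟩ := (orbitDeriv_bijective φ hφ).2 v
    obtain ⟨b, rfl⟩ := (orbitDeriv_bijective φ hφ).2 w
    rw [hm.2, hm'.2]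
  cases m
  cases m'
  congr

end FubiniStudyMetric

/-! ### P(H) as a complex symmetric space -/

section SymmetricSpace

variable {H : Type u} [NormedAddCommGroup H] [InnerProductSpace ℂ H] [CompleteSpace H]
  [Nontrivial H]

theorem isHomogeneousGSpace_projectivization :
    IsHomogeneousGSpace (LieU H) (U H) (PModel H) (ℙ ℂ H) where
  completeSpace_group :=
    (isClosed_eq (f := fun T : H →L[ℂ] H => star T) (g := fun T => -T) continuous_star
      continuous_neg).completeSpace_coe
  lieGroup := inferInstance
  t2Space_group := inferInstance
  connectedSpace_group := inferInstance
  completeSpace := inferInstance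
  isManifold := inferInstance
  t2Space := inferInstance
  connectedSpace := inferInstance
  contMDiff_smul := contMDiff_unitary_smul
  isPretransitive := inferInstance
  isLieSubgroup_stabilizer := isLieSubgroup_stabilizer

theorem isComplexSymmetricGSpace_projectivization (φ : H) (hφ : ‖φ‖ = 1) :
    IsComplexSymmetricGSpace (LieU H) (PModel H) (fun x : ℙ ℂ H => reflS φ • x) (rayOf φ hφ)
      (MulAut.conj (reflS φ)) where
  toIsHomogeneousGSpace := isHomogeneousGSpace_projectivization
  involutive x := by
    beta_reduce
    rw [smul_smul, reflS_mul_self, one_smul]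
  contMDiff := contMDiff_unitary_smul_left _
  fixed := reflS_mem_stabilizer φ hφ
  isolated := by
    filter_upwards [(isOpen_inner_rep_ne_zero φ).mem_nhds (inner_rep_rayOf_ne_zero φ hφ)] with x hx
    exact eq_rayOf_of_reflS_smul_eq φ hφ hx
  symmetry_eq g h hgh x := by
    -- The symmetry is well defined because the isotropy group commutes with S.
    have hk : h⁻¹ * g ∈ MulAction.stabilizer (U H) (rayOf φ hφ) := by
      rw [MulAction.mem_stabilizer_iff, mul_smul, hgh, inv_smul_smul]
    have hc := (mem_stabilizer_iff_conj φ hφ _).1 hk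
    rw [MulAut.conj_apply, mul_inv_eq_iff_eq_mul] at hc
    simp only [smul_smul]
    congr 1
    calc g * (reflS φ * g⁻¹) = h * (h⁻¹ * g * reflS φ) * g⁻¹ := by group
      _ = h * (reflS φ * (h⁻¹ * g)) * g⁻¹ := by rw [hc]
      _ = h * (reflS φ * h⁻¹) := by group
  involutive_aut g := by
    rw [MulAut.conj_apply, MulAut.conj_apply, inv_reflS]
    calc reflS φ * (reflS φ * g * reflS φ) * reflS φ
        = (reflS φ * reflS φ) * g * (reflS φ * reflS φ) := by group
      _ = g := by rw [reflS_mul_self, one_mul, mul_one]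
  contMDiff_aut := contMDiff_conj_reflS φ
  map_smul g x := by
    rw [MulAut.conj_apply, smul_smul, smul_smul, inv_mul_cancel_right]
  isManifold_complex := inferInstance
  holomorphic_symmetry g := by
    -- Each symmetry is itself the action of a unitary operator, g S g⁻¹.
    simpa only [smul_smul] using contMDiff_holomorphic_smul (g * (reflS φ * g⁻¹))
  holomorphic_smul := contMDiff_holomorphic_smul

end SymmetricSpace

end ProjectiveHilbert

theorem proposition1 {H : Type*} [NormedAddCommGroup H] [InnerProductSpace ℂ H] [CompleteSpace H]
    [Nontrivial H] (χ : H) (hχ : ‖χ‖ = 1) (ħ : ℝ) (hħ : 0 < ħ) :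
    -- `P(H)` is a complex symmetric `U(H)`-space, with the symmetry at the ray of `χ` induced by
    -- `S = 1 - 2 P_χ` and the involutive automorphism `g ↦ S g S⁻¹`
    IsComplexSymmetricGSpace (LieU H) (PModel H) (fun x : ℙ ℂ H => reflS χ • x) (rayOf χ hχ)
      (MulAut.conj (reflS χ)) ∧
    (TopologicalSpace.SeparableSpace H → SecondCountableTopology (ℙ ℂ H)) ∧
    IsOpenQuotientMap (fun g : U H => g • rayOf χ hχ) ∧
    -- the isotropy group at the ray of `χ` is the stabiliser of the line spanned by `χ`, the
    -- commutant of `P_χ` in `U(H)`, and the fixed point group of `g ↦ S g S⁻¹`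
    (∀ g : U H, g ∈ MulAction.stabilizer (U H) (rayOf χ hχ) ↔
      (ℂ ∙ χ).map ((g : H →L[ℂ] H) : H →ₗ[ℂ] H) = ℂ ∙ χ) ∧
    (∀ g : U H, g ∈ MulAction.stabilizer (U H) (rayOf χ hχ) ↔
      rayProj χ * (g : H →L[ℂ] H) = g * rayProj χ) ∧
    (∀ g : U H, g ∈ MulAction.stabilizer (U H) (rayOf χ hχ) ↔
      MulAut.conj (reflS χ) g = g) ∧
    -- `𝔲(H)` is the tangent space of `U(H)` at the identity, and the Lie algebra of the isotropy
    -- group is the commutant `𝔥` of `P_χ`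
    HasMFDerivAt 𝓘(ℝ, LieU H) 𝓘(ℝ, H →L[ℂ] H) (fun g : U H => (g : H →L[ℂ] H)) 1
      (skewAdjoint.submodule ℝ (H →L[ℂ] H)).subtypeL ∧
    (∀ a : LieU H, a ∈ commutant χ ↔
      ∀ t : ℝ, ∃ g ∈ MulAction.stabilizer (U H) (rayOf χ hχ),
        (g : H →L[ℂ] H) = NormedSpace.exp (t • (a : H →L[ℂ] H))) ∧
    -- `𝔪` is the `-1` eigenspace of the differential of `g ↦ S g S⁻¹` at the identity, it is
    -- invariant under the isotropy group, and `𝔲(H) = 𝔥 ⊕ 𝔪`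
    HasMFDerivAt 𝓘(ℝ, LieU H) 𝓘(ℝ, LieU H) (MulAut.conj (reflS χ)) (1 : U H) (AdL (reflS χ)) ∧
    (∀ a : LieU H, a ∈ anticommutant χ ↔ AdL (reflS χ) a = -a) ∧
    (∀ g ∈ MulAction.stabilizer (U H) (rayOf χ hχ), ∀ a ∈ anticommutant χ,
      AdL g a ∈ anticommutant χ) ∧
    IsCompl (commutant χ) (anticommutant χ) ∧
    -- `𝔪` is the tangent space of `P(H)` at the ray of `χ`, in the chart `b_χ` through `A ↦ A χ`, and
    -- the complex structure of `χ^⊥` gives the one of `P(H)`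
    (∀ a : LieU H, orbitDeriv (rayOf χ hχ) a = 0 ↔ a ∈ commutant χ) ∧
    Function.Bijective (fun a : anticommutant χ => orbitDeriv (rayOf χ hχ) a) ∧
    (∀ a ∈ anticommutant χ,
      (affineDeriv χ hχ (orbitDeriv (rayOf χ hχ) a) : H) = (a : H →L[ℂ] H) χ) ∧
    (∀ a ∈ anticommutant χ, ∀ b ∈ anticommutant χ,
      (b : H →L[ℂ] H) χ = Complex.I • (a : H →L[ℂ] H) χ →
        orbitDeriv (rayOf χ hχ) b = complexStructure _ (orbitDeriv (rayOf χ hχ) a)) ∧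
    -- `(A, B) = -ħ Tr (A B)` is a scalar product on `𝔪`, invariant under the isotropy group, and the
    -- metric that it induces on `P(H)` exists, is unique, and is the Fubini-Study metric
    ∃ β : anticommutant χ →L[ℝ] anticommutant χ →L[ℝ] ℝ,
      (∀ a b : anticommutant χ, ∃ t : ℂ,
        HasTrace (((a : LieU H) : H →L[ℂ] H) * ((b : LieU H) : H →L[ℂ] H)) t ∧
          (β a b : ℂ) = -ħ * t) ∧
      (∀ a b, β a b = β b a) ∧
      (∀ a, a ≠ 0 → 0 < β a a) ∧
      (∀ g ∈ MulAction.stabilizer (U H) (rayOf χ hχ), ∀ a b a' b' : anticommutant χ,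
        (a' : LieU H) = AdL g a → (b' : LieU H) = AdL g b → β a' b' = β a b) ∧
      (∃! m : ProjMetric H, IsInducedMetric χ hχ β m) ∧
      (∀ m : ProjMetric H, IsInducedMetric χ hχ β m → IsFubiniStudy ħ m) := by
  refine ⟨isComplexSymmetricGSpace_projectivization χ hχ,
    fun _ => secondCountableTopology_projectivization, isOpenQuotientMap_orbit χ hχ,
    mem_stabilizer_iff_map χ hχ, mem_stabilizer_iff_commute χ hχ, mem_stabilizer_iff_conj χ hχ,
    hasMFDerivAt_coe_unitary_one, mem_commutant_iff_exp χ hχ, hasMFDerivAt_conj_reflS χ,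
    mem_anticommutant_iff χ, fun g hg a ha => AdL_mem_anticommutant χ hχ hg ha,
    isCompl_commutant_anticommutant χ, orbitDeriv_eq_zero_iff χ hχ, orbitDeriv_bijective χ hχ,
    fun a ha => coe_affineDeriv_orbitDeriv hχ ha,
    fun a ha b hb h => orbitDeriv_complexStructure hχ ha hb h,
    traceForm ħ χ, fun a b => ⟨_, hasTrace_mul_of_mem_anticommutant hχ a.2 b.2, ?_⟩,
    traceForm_symm ħ χ, fun a ha => traceForm_pos hħ hχ ha,
    fun g hg a b a' b' ha hb => traceForm_AdL ħ hχ hg ha hb,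
    ⟨fubiniStudyMetric ħ hħ, isInducedMetric_fubiniStudyMetric ħ hħ χ hχ,
      fun m hm => eq_of_isInducedMetric hm (isInducedMetric_fubiniStudyMetric ħ hħ χ hχ)⟩,
    fun m hm => ?_⟩
  · rw [traceForm_apply]
    push_cast
    ring
  · rw [eq_of_isInducedMetric hm (isInducedMetric_fubiniStudyMetric ħ hħ χ hχ)]
    exact isFubiniStudy_fubiniStudyMetric ħ hħ
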